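/- Let $m,n\in\mathbb N$ with $M:=m-2n>0$. Let $\Lambda_{2n}$ be the complex Grassmann algebra with anticommuting generators $\grave x_1,\dots,\grave x_{2n}$ and $\mathcal P=\mathbb C[x_1,\dots,x_m]\otimes\Lambda_{2n}$. Put $$r^2=\sum_{i}x_i^2,\quad \theta^2=-\sum_{j=1}^n\grave x_{2j-1}\grave x_{2j},\quad R^2=r^2+\theta^2,$$ $$\nabla_f^2=-4\sum_{j=1}^n\partial_{\grave x_{2j-1}}\partial_{\grave x_{2j}},\quad \nabla^2=\sum_i\partial_{x_i}^2+\nabla_f^2,\quad \mathbb E=\sum_i x_i\partial_{x_i}+\sum_j\grave x_j\partial_{\grave x_j},$$ where $\partial_{\grave x_j}$ are left derivatives. Let $\exp(-R^2/2)=\exp(-r^2/2)\sum_{j=0}^n\frac{(-1)^j\theta^{2j}}{2^jj!}$ and $$\int_{\mathbb R^{m|2n}}f=\int_{\mathbb R^m}\pi^{-n}\,\partial_{\grave x_{2n}}\cdots\partial_{\grave x_1}f\;dV .$$ Let $\mathcal H^b_p$ be the space of homogeneous harmonic polynomials of degree $p$ in $\mathbb C[x_1,\dots,x_m]$, and $\mathcal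 H^f_q$ the space of homogeneous elements of degree $q$ of $\Lambda_{2n}$ killed by $\nabla^2_f$. For $i+q\le n$ let $$f_{i,p,q}=\sum_{s=0}^i\binom is\frac{(n-q-s)!}{\Gamma(\frac m2+p+i-s)}\frac{\Gamma(\frac m2+p+i)}{(n-q-i)!}\,r^{2i-2s}\theta^{2s}.$$ Let $a\mapsto\tilde a$ be the linear map on $\Lambda_{2n}$ with $\tilde{\grave x}_{2j-1}=\grave x_{2j}$, $\tilde{\grave x}_{2j}=-\grave x_{2j-1}$ and $\widetilde{ab}=\tilde b\tilde a$. Then there is exactly one linear map $T$ on $\mathcal P\exp(-R^2/2)$ such that $$T\big(R^{2j}f_{i,p,q}H^bH^f\exp(-R^2/2)\big)=(-1)^iR^{2j}f_{i,p,q}H^b\widetilde{H^f}\exp(-R^2/2)$$ for all $j,i,p,q\in\mathbb N$ with $i+q\le n$, $H^b\in\mathcal H^b_p$ and $H^f\in\mathcal H^f_q$. Put $$\langle f|g\rangle_2=\int_{\mathbb R^{m|2n}}f\,\overline{T(g)},\qquad f,g\in\mathcal P\exp(-R^2/2),$$ where the bar is complex conjugation of the coefficient functions, and write $A^\dagger=B$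 if $A$ and $B$ map $\mathcal P\exp(-R^2/2)$ to itself and $\langle Af|g\rangle_2=\langle f|Bg\rangle_2$ for all $f,g$ in it. Then $$(R^2)^\dagger=R^2,\qquad(\nabla^2)^\dagger=\nabla^2,\qquad(2\mathbb E+M)^\dagger=-(2\mathbb E+M).$$ Moreover, for every polynomial $V$ with real coefficients, the Schrödinger operator $-\nabla^2/2+V(R^2)$ is symmetric: $(-\nabla^2/2+V(R^2))^\dagger=-\nabla^2/2+V(R^2)$. -/

import Mathlib

open scoped TensorProduct ContDiff

noncomputable section

namespace SuperSpace

/-! ### The Grassmann algebra with `2n` generators -/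

/-- The complex Grassmann algebra on `2n` generators. -/
abbrev Grassmann (n : ℕ) : Type := ExteriorAlgebra ℂ (Fin (2 * n) → ℂ)

/-- The `k`-th anticommuting generator. With indices counted from `0`, the generators
`x̀_{2j-1}, x̀_{2j}` of the usual numbering, `j = 1, …, n`, are `gen (odd j)` and `gen (even j)`
for `j : Fin n`. -/
def gen {n : ℕ} (k : Fin (2 * n)) : Grassmann n := ExteriorAlgebra.ι ℂ (Pi.single k 1)

def odd {n : ℕ} (j : Fin n) : Fin (2 * n) := ⟨2 * j, by omega⟩

def even {n : ℕ} (j : Fin n) : Fin (2 * n) := ⟨2 * j + 1, by omega⟩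

/-- The left derivative `∂_{x̀_k}`: it kills scalars and satisfies
`∂_k (v * f) = (v)_k • f - v * ∂_k f` for `v` in the span of the generators. -/
def gDeriv {n : ℕ} (k : Fin (2 * n)) : Module.End ℂ (Grassmann n) :=
  CliffordAlgebra.contractLeft (LinearMap.proj k)

/-- `θ² = -∑ x̀_{2j-1} x̀_{2j}`. -/
def theta2 (n : ℕ) : Grassmann n := -∑ j : Fin n, gen (odd j) * gen (even j)

/-- The fermionic Laplace operator `-4 ∑ ∂_{2j-1} ∂_{2j}`. -/
def lapF (n : ℕ) : Module.End ℂ (Grassmann n) :=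
  (-4 : ℂ) • ∑ j : Fin n, gDeriv (odd j) * gDeriv (even j)

/-- The fermionic Euler operator `∑ x̀_k ∂_k`. -/
def eulerF (n : ℕ) : Module.End ℂ (Grassmann n) :=
  ∑ k : Fin (2 * n), LinearMap.mulLeft ℂ (gen k) * gDeriv k

/-- The Berezin integral `π^{-n} ∂_{2n} ⋯ ∂_1`, read as a complex number. -/
def berezin (n : ℕ) : Grassmann n →ₗ[ℂ] ℂ :=
  (((Real.pi : ℂ) ^ n)⁻¹) •
    (ExteriorAlgebra.algebraMapInv.toLinearMap ∘ₗ
      (List.ofFn (fun k : Fin (2 * n) => gDeriv k)).reverse.prod)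

/-- The Grassmann algebra as a ring, made a complex algebra in which `c` acts as its conjugate. -/
def ConjGrassmann (n : ℕ) : Type := Grassmann n

instance (n : ℕ) : Ring (ConjGrassmann n) := inferInstanceAs (Ring (Grassmann n))

instance (n : ℕ) : Algebra ℂ (ConjGrassmann n) :=
  ((algebraMap ℂ (Grassmann n)).comp (starRingEnd ℂ)).toAlgebra'
    (fun c x => Algebra.commutes (A := Grassmann n) (starRingEnd ℂ c) x)

/-- `v ↦ ι (conj v)`, a linear map into the conjugate algebra. -/
def conjGen (n : ℕ) : (Fin (2 * n) → ℂ) →ₗ[ℂ] ConjGrassmann n where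
  toFun v := (ExteriorAlgebra.ι ℂ (fun k => starRingEnd ℂ (v k)) : Grassmann n)
  map_add' v w := by
    have h : (fun k => starRingEnd ℂ ((v + w) k))
        = (fun k => starRingEnd ℂ (v k)) + (fun k => starRingEnd ℂ (w k)) := by
      funext k
      simp
    rw [h, map_add]
    rfl
  map_smul' c v := by
    have h : (fun k => starRingEnd ℂ ((c • v) k))
        = (starRingEnd ℂ c) • (fun k => starRingEnd ℂ (v k)) := by
      funext k
      simp
    rw [h, map_smul, Algebra.smul_def]
    rfl

/-- Complex conjugation on the Grassmann algebra as a complex algebra homomorphism into the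
conjugate algebra: on the generators it is `ι v ↦ ι (conj v)`. -/
def gConjHom (n : ℕ) : Grassmann n →ₐ[ℂ] ConjGrassmann n :=
  ExteriorAlgebra.lift ℂ ⟨conjGen n, fun v =>
    ExteriorAlgebra.ι_sq_zero (R := ℂ) (fun k => starRingEnd ℂ (v k))⟩

/-- Complex conjugation `∑ f_A x̀_A ↦ ∑ conj f_A x̀_A`. -/
def gConj (n : ℕ) : Grassmann n →ₛₗ[starRingEnd ℂ] Grassmann n where
  toFun x := (gConjHom n x : ConjGrassmann n)
  map_add' x y := map_add (gConjHom n) x y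
  map_smul' c x :=
    (map_smul (gConjHom n) c x).trans <|
      (Algebra.smul_def (A := ConjGrassmann n) c (gConjHom n x)).trans
        (Algebra.smul_def (A := Grassmann n) (starRingEnd ℂ c) (gConjHom n x)).symm

theorem gConj_gen {n : ℕ} (k : Fin (2 * n)) : gConj n (gen k) = gen k := by
  have h : gConj n (gen k)
      = ExteriorAlgebra.ι ℂ (fun l => starRingEnd ℂ ((Pi.single k 1 : Fin (2 * n) → ℂ) l)) :=
    ExteriorAlgebra.lift_ι_apply ℂ (conjGen n) _ (Pi.single k 1)
  rw [h, gen]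
  congr 1
  funext l
  by_cases hl : l = k
  · subst hl
    simp
  · simp [Pi.single_eq_of_ne hl]

theorem gConj_one (n : ℕ) : gConj n 1 = 1 := map_one (gConjHom n)

theorem gConj_mul {n : ℕ} (x y : Grassmann n) : gConj n (x * y) = gConj n x * gConj n y :=
  map_mul (gConjHom n) x y

/-- The linear map on generators `x̀_{2j-1} ↦ x̀_{2j}`, `x̀_{2j} ↦ -x̀_{2j-1}`. -/
def genTwist (n : ℕ) : (Fin (2 * n) → ℂ) →ₗ[ℂ] (Fin (2 * n) → ℂ) :=
  ∑ j : Fin n,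
    ((LinearMap.proj (odd j) : (Fin (2 * n) → ℂ) →ₗ[ℂ] ℂ).smulRight (Pi.single (even j) 1)
      - (LinearMap.proj (even j) : (Fin (2 * n) → ℂ) →ₗ[ℂ] ℂ).smulRight (Pi.single (odd j) 1))

/-- The linear map `f ↦ f̃` with `x̀_{2j-1} ↦ x̀_{2j}`, `x̀_{2j} ↦ -x̀_{2j-1}` and
`(a b)~ = b̃ ã`. -/
def tilde (n : ℕ) : Grassmann n →ₗ[ℂ] Grassmann n :=
  CliffordAlgebra.reverse ∘ₗ (ExteriorAlgebra.map (genTwist n)).toLinearMap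

/-- Fermionic spherical harmonics of degree `q`. -/
def harmonicF (n q : ℕ) : Submodule ℂ (Grassmann n) :=
  (⋀[ℂ]^q (Fin (2 * n) → ℂ)) ⊓ LinearMap.ker (lapF n)

/-- The fermionic Gaussian `exp(-θ²/2)`, a finite Taylor sum. -/
def gaussF (n : ℕ) : Grassmann n :=
  ∑ j ∈ Finset.range (n + 1), ((-1 : ℂ) ^ j / (2 ^ j * (j.factorial : ℂ))) • theta2 n ^ j

/-! ### Smooth functions of the commuting variables -/

/-- The algebra of smooth complex functions on `ℝ^m`. -/
def smooth (m : ℕ) : Subalgebra ℂ (EuclideanSpace ℝ (Fin m) → ℂ) where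
  carrier := {f | ContDiff ℝ ∞ f}
  mul_mem' {f g} (hf : ContDiff ℝ ∞ f) (hg : ContDiff ℝ ∞ g) :=
    (hf.mul hg : ContDiff ℝ ∞ (f * g))
  add_mem' {f g} (hf : ContDiff ℝ ∞ f) (hg : ContDiff ℝ ∞ g) :=
    (hf.add hg : ContDiff ℝ ∞ (f + g))
  algebraMap_mem' c := (contDiff_const : ContDiff ℝ ∞ fun _ => c)

/-- The coordinate function `x_i`. -/
def coord {m : ℕ} (i : Fin m) : smooth m :=
  ⟨fun x => ((x i : ℝ) : ℂ), by
    change ContDiff ℝ ∞ _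
    exact Complex.ofRealCLM.contDiff.comp (EuclideanSpace.proj (𝕜 := ℝ) i).contDiff⟩

/-- The bosonic Gaussian `exp(-r²/2)`. -/
def gaussB (m : ℕ) : smooth m :=
  ⟨fun x => ((Real.exp (-(∑ i, x i ^ 2) / 2) : ℝ) : ℂ), by
    change ContDiff ℝ ∞ _
    refine Complex.ofRealCLM.contDiff.comp (Real.contDiff_exp.comp (ContDiff.div_const
      (ContDiff.neg (ContDiff.sum fun i _ => ?_)) _))
    exact (EuclideanSpace.proj (𝕜 := ℝ) i).contDiff.pow 2⟩

/-- The partial derivative `∂_{x_i}` on smooth functions. -/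
def bDeriv {m : ℕ} (i : Fin m) : Module.End ℂ (smooth m) where
  toFun f := ⟨fun x => fderiv ℝ f.1 x (EuclideanSpace.single i 1), by
    have h : ContDiff ℝ ∞ f.1 := f.2
    change ContDiff ℝ ∞ _
    exact (h.fderiv_right (m := ∞) (by simp)).clm_apply contDiff_const⟩
  map_add' f g := by
    have hf : ContDiff ℝ ∞ f.1 := f.2
    have hg : ContDiff ℝ ∞ g.1 := g.2
    ext x
    change fderiv ℝ (f.1 + g.1) x _ = fderiv ℝ f.1 x _ + fderiv ℝ g.1 x _
    rw [fderiv_add (hf.differentiable (by simp) x) (hg.differentiable (by simp) x)]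
    rfl
  map_smul' c f := by
    have hf : ContDiff ℝ ∞ f.1 := f.2
    ext x
    change fderiv ℝ (c • f.1) x _ = c • fderiv ℝ f.1 x _
    rw [fderiv_const_smul (hf.differentiable (by simp) x)]
    rfl

/-- Pointwise complex conjugation of smooth functions. -/
def bConj (m : ℕ) : smooth m →ₛₗ[starRingEnd ℂ] smooth m where
  toFun f := ⟨fun x => starRingEnd ℂ (f.1 x), by
    have h : ContDiff ℝ ∞ f.1 := f.2
    change ContDiff ℝ ∞ _
    exact Complex.conjCLE.contDiff.comp h⟩
  map_add' f g := by
    ext x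
    exact map_add (starRingEnd ℂ) (f.1 x) (g.1 x)
  map_smul' c f := by
    ext x
    exact map_mul (starRingEnd ℂ) c (f.1 x)

/-- Bosonic spherical harmonics of degree `p`: homogeneous harmonic polynomials. -/
def harmonicB (m p : ℕ) : Submodule ℂ (MvPolynomial (Fin m) ℂ) :=
  MvPolynomial.homogeneousSubmodule (Fin m) ℂ p ⊓
    LinearMap.ker (∑ i : Fin m, (MvPolynomial.pderiv i).toLinearMap ∘ₗ
      (MvPolynomial.pderiv i).toLinearMap)

/-! ### Superfunctions -/

/-- Smooth superfunctions on `ℝ^{m|2n}`: `C^∞(ℝ^m) ⊗ Λ_{2n}`. -/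
abbrev SuperFun (m n : ℕ) : Type := smooth m ⊗[ℂ] Grassmann n

instance (m n : ℕ) : Ring (SuperFun m n) := Algebra.TensorProduct.instRing

instance (m n : ℕ) : AddCommGroup (SuperFun m n) := TensorProduct.addCommGroup

/-- Superpolynomials: `ℂ[x_1, …, x_m] ⊗ Λ_{2n}`. -/
abbrev SuperPoly (m n : ℕ) : Type := MvPolynomial (Fin m) ℂ ⊗[ℂ] Grassmann n

instance (m n : ℕ) : Ring (SuperPoly m n) := Algebra.TensorProduct.instRing

instance (m n : ℕ) : AddCommGroup (SuperPoly m n) := TensorProduct.addCommGroup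

/-- Superpolynomials as superfunctions. -/
def polyFun (m n : ℕ) : SuperPoly m n →ₐ[ℂ] SuperFun m n :=
  Algebra.TensorProduct.map (MvPolynomial.aeval (coord (m := m))) (AlgHom.id ℂ (Grassmann n))

/-- `r²` as a superpolynomial. -/
def r2 (m n : ℕ) : SuperPoly m n := (∑ i : Fin m, MvPolynomial.X i ^ 2) ⊗ₜ 1

/-- `θ²` as a superpolynomial. -/
def th2 (m n : ℕ) : SuperPoly m n := 1 ⊗ₜ theta2 n

/-- `R² = r² + θ²`. -/
def R2 (m n : ℕ) : SuperPoly m n := r2 m n + th2 m n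

/-- Multiplication by `R²` on superfunctions. -/
def mulR2 (m n : ℕ) : Module.End ℂ (SuperFun m n) :=
  LinearMap.mulLeft ℂ (polyFun m n (R2 m n))

/-- The super Laplace operator `∇² = ∑ ∂_{x_i}² - 4 ∑ ∂_{x̀_{2j-1}} ∂_{x̀_{2j}}`. -/
def lap (m n : ℕ) : Module.End ℂ (SuperFun m n) :=
  LinearMap.rTensor (Grassmann n) (∑ i : Fin m, bDeriv i * bDeriv i)
    + LinearMap.lTensor (smooth m) (lapF n)

/-- The super Euler operator. -/
def euler (m n : ℕ) : Module.End ℂ (SuperFun m n) :=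
  LinearMap.rTensor (Grassmann n) (∑ i : Fin m, LinearMap.mulLeft ℂ (coord i) * bDeriv i)
    + LinearMap.lTensor (smooth m) (eulerF n)

/-- The super-dimension `M = m - 2n`. -/
def superDim (m n : ℕ) : ℤ := (m : ℤ) - 2 * (n : ℤ)

/-- The operator `2𝔼 + M`. -/
def eulerShift (m n : ℕ) : Module.End ℂ (SuperFun m n) :=
  (2 : ℂ) • euler m n + ((superDim m n : ℤ) : ℂ) • 1

/-- The Schrödinger operator `-∇²/2 + V(R²)` with a real polynomial `V`. -/
def schrodinger (m n : ℕ) (V : Polynomial ℝ) : Module.End ℂ (SuperFun m n) :=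
  (-(1 / 2) : ℂ) • lap m n
    + Polynomial.aeval (mulR2 m n) (V.map (algebraMap ℝ ℂ))

/-- The integral over `ℝ^{m|2n}`: the Berezin integral followed by the Lebesgue integral. -/
def superInt {m n : ℕ} (f : SuperFun m n) : ℂ :=
  ∫ x : EuclideanSpace ℝ (Fin m),
    (TensorProduct.rid ℂ (smooth m) (LinearMap.lTensor (smooth m) (berezin n) f)).1 x

/-- Complex conjugation of superfunctions. -/
def superConj (m n : ℕ) : SuperFun m n →ₛₗ[starRingEnd ℂ] SuperFun m n :=
  TensorProduct.map (bConj m) (gConj n)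

/-- `P ↦ P exp(-R²/2)`, where `exp(-R²/2) = exp(-r²/2) exp(-θ²/2)`. -/
def mulGauss (m n : ℕ) : SuperPoly m n →ₗ[ℂ] SuperFun m n :=
  LinearMap.mulRight ℂ (gaussB m ⊗ₜ gaussF n) ∘ₗ (polyFun m n).toLinearMap

/-- The space `𝒫 exp(-R²/2)`. -/
def polyGauss (m n : ℕ) : Submodule ℂ (SuperFun m n) := LinearMap.range (mulGauss m n)

/-! ### The map `T` and the inner product -/

/-- The polynomial `f_{k,p,q}(r²,θ²) = ∑_{s ≤ k} a_s r^{2k-2s} θ^{2s}`, for `k ≤ n - q`, with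
`a_s = binom(k,s) ((n-q-s)! / Γ(m/2+p+k-s)) (Γ(m/2+p+k) / (n-q-k)!)`. -/
def fPoly (m n k p q : ℕ) : SuperPoly m n :=
  ∑ s ∈ Finset.range (k + 1),
    (((k.choose s : ℝ) * (((n - q - s).factorial : ℝ) / Real.Gamma ((m : ℝ) / 2 + p + k - s))
        * (Real.Gamma ((m : ℝ) / 2 + p + k) / ((n - q - k).factorial : ℝ)) : ℝ) : ℂ)
      • (r2 m n ^ (k - s) * th2 m n ^ s)

/-- `T` is the linear map on `𝒫 exp(-R²/2)` given on the pieces of the Fischer decomposition by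
`T(R^{2j} f_{i,p,q} H^b_p H^f_q exp(-R²/2)) = (-1)^i R^{2j} f_{i,p,q} H^b_p H̃^f_q exp(-R²/2)`. -/
def IsTwist (m n : ℕ) (T : polyGauss m n →ₗ[ℂ] polyGauss m n) : Prop :=
  ∀ j i p q : ℕ, i + q ≤ n → ∀ h ∈ harmonicB m p, ∀ w ∈ harmonicF n q,
    T ((mulGauss m n).rangeRestrict (R2 m n ^ j * fPoly m n i p q * (h ⊗ₜ w)))
      = (mulGauss m n).rangeRestrict
          ((-1 : ℂ) ^ i • (R2 m n ^ j * fPoly m n i p q * (h ⊗ₜ tilde n w)))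

/-- The map `T` on `𝒫 exp(-R²/2)`; for `M > 0` it is the unique map satisfying `IsTwist`. -/
def twist (m n : ℕ) : polyGauss m n →ₗ[ℂ] polyGauss m n :=
  Classical.epsilon (IsTwist m n)

/-- `⟨f|g⟩₂ = ∫_{ℝ^{m|2n}} f conj(T(g))` on `𝒫 exp(-R²/2)`. -/
def inner2 {m n : ℕ} (f g : polyGauss m n) : ℂ :=
  superInt ((f : SuperFun m n) * superConj m n (twist m n g : SuperFun m n))

/-- `A† = B` on `𝒫 exp(-R²/2)`: both operators preserve this space, and
`⟨A f|g⟩₂ = ⟨f|B g⟩₂` for all `f`, `g` in it. -/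
def IsAdjoint {m n : ℕ} (A B : Module.End ℂ (SuperFun m n)) : Prop :=
  ∃ (hA : ∀ f ∈ polyGauss m n, A f ∈ polyGauss m n)
    (hB : ∀ f ∈ polyGauss m n, B f ∈ polyGauss m n),
    ∀ f g : polyGauss m n, inner2 (A.restrict hA f) g = inner2 f (B.restrict hB g)

end SuperSpace

end

/-!
The operators `R²`, `∇²` and `𝔼 + M/2` on superpolynomials form an `sl₂`-triple, the tensor product
of a bosonic and a fermionic one. When `M ∉ -2ℕ`, the pieces `R^{2j} f_{i,p,q} H^b_p H^f_q` of the
Fischer decomposition span `𝒫` and are joint eigenspaces of four operators (the weight `𝔼 + M/2`,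
`R²∇²`, and the bosonic and fermionic Casimir operators) that separate the indices `j, i, p, q`.
Hence their sum is direct, and `T` exists and is unique. Since `R²` and `∇²` change `j` alone, up to
a scalar, and the rule defining `T` does not depend on `j`, it commutes with the whole triple.

Conjugation by the Gaussian turns `∇²` into `∇² - (2𝔼 + M) + R²`, so `T` commutes with `R²` and
`∇²` on `𝒫 exp(-R²/2)` as well. Multiplication by `R²` is symmetric for the bilinear superintegral,
`∇²` is so by integration by parts in both kinds of variables, and `2𝔼 + M` is half the commutator
`[∇², R²]`.
-/

noncomputable section

namespace SuperSpace

/-! ### Triples satisfying the `sl₂` relations -/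

/-- The relations `[H, X] = 2 X` and `[Y, X] = 4 H` of an `sl₂`-triple, in the normalization of
`X = r²`, `Y = ∇²`, `H = 𝔼 + M/2`. The third relation `[H, Y] = -2 Y` is left out: lowest weight
vectors are raised by `X` only. -/
structure SlTriple {A : Type*} [Ring A] (X Y H : A) : Prop where
  weight_mul_raise : H * X = X * H + 2 • X
  lower_mul_raise : Y * X = X * Y + 4 • H

namespace SlTriple

section Ring

variable {A : Type*} [Ring A] {X Y H : A}

theorem weight_mul_raise_pow (t : SlTriple X Y H) (j : ℕ) :
    H * X ^ j = X ^ j * H + (2 * j) • X ^ j := by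
  induction j with
  | zero => simp
  | succ j ih =>
    calc H * X ^ (j + 1) = H * X ^ j * X := by rw [pow_succ, mul_assoc]
      _ = X ^ j * (H * X) + (2 * j) • X ^ (j + 1) := by
        rw [ih, add_mul, mul_assoc, smul_mul_assoc, pow_succ]
      _ = X ^ (j + 1) * H + (2 * (j + 1)) • X ^ (j + 1) := by
        rw [t.weight_mul_raise, mul_add, mul_smul_comm, ← mul_assoc, ← pow_succ]
        module

theorem lower_mul_raise_pow (t : SlTriple X Y H) (j : ℕ) :
    Y * X ^ (j + 1) = X ^ (j + 1) * Y + (4 * (j + 1)) • (X ^ j * H + j • X ^ j) := by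
  induction j with
  | zero => simp [t.lower_mul_raise]
  | succ j ih =>
    calc Y * X ^ (j + 2) = Y * X ^ (j + 1) * X := by rw [pow_succ _ (j + 1), mul_assoc]
      _ = X ^ (j + 1) * (Y * X)
          + (4 * (j + 1)) • (X ^ j * (H * X) + j • X ^ (j + 1)) := by
        rw [ih, add_mul, mul_assoc, smul_mul_assoc, add_mul, smul_mul_assoc, mul_assoc, pow_succ]
      _ = X ^ (j + 2) * Y
          + (4 * (j + 1 + 1)) • (X ^ (j + 1) * H + (j + 1) • X ^ (j + 1)) := by
        rw [t.weight_mul_raise, t.lower_mul_raise, mul_add, mul_smul_comm, mul_add (X ^ j),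
          ← mul_assoc, ← pow_succ, mul_smul_comm, ← mul_assoc, ← pow_succ]
        module

theorem commute_weight [IsAddTorsionFree A] (t : SlTriple X Y H) {T : A} (hX : Commute T X)
    (hY : Commute T Y) : Commute T H := by
  have h : 4 • H = Y * X - X * Y := by rw [t.lower_mul_raise, add_sub_cancel_left]
  have h4 : Commute T (4 • H) := h ▸ (hY.mul_right hX).sub_right (hX.mul_right hY)
  refine nsmul_right_injective (n := 4) (by norm_num) ?_
  simpa only [mul_smul_comm, smul_mul_assoc] using h4.eq

end Ring

section LowestWeight

variable {K V : Type*} [CommRing K] [AddCommGroup V] [Module K V] {X Y H : Module.End K V}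

theorem weight_raise (t : SlTriple X Y H) (v : V) : H (X v) = X (H v) + (2 : K) • X v := by
  have h : H (X v) = X (H v) + 2 • X v := LinearMap.congr_fun t.weight_mul_raise v
  rw [h]
  module

theorem lower_raise (t : SlTriple X Y H) (v : V) : Y (X v) = X (Y v) + (4 : K) • H v := by
  have h : Y (X v) = X (Y v) + 4 • H v := LinearMap.congr_fun t.lower_mul_raise v
  rw [h]
  module

variable {v : V} {c : K}

theorem weight_raise_pow_of_eigen (t : SlTriple X Y H) (j : ℕ) (hv : H v = c • v) :
    H ((X ^ j) v) = (c + 2 * j) • (X ^ j) v := by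
  have h : H ((X ^ j) v) = (X ^ j) (H v) + (2 * j) • (X ^ j) v :=
    LinearMap.congr_fun (t.weight_mul_raise_pow j) v
  rw [h, hv, map_smul]
  module

theorem lower_raise_pow_of_eigen (t : SlTriple X Y H) (j : ℕ) (hv : H v = c • v) :
    Y ((X ^ (j + 1)) v)
      = (X ^ (j + 1)) (Y v) + (4 * (j + 1) * (c + j) : K) • (X ^ j) v := by
  have h : Y ((X ^ (j + 1)) v)
      = (X ^ (j + 1)) (Y v) + (4 * (j + 1)) • ((X ^ j) (H v) + j • (X ^ j) v) :=
    LinearMap.congr_fun (t.lower_mul_raise_pow j) v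
  rw [h, hv, map_smul]
  module

theorem lower_raise_pow_of_ker (t : SlTriple X Y H) (j : ℕ) (hv : H v = c • v) (h0 : Y v = 0) :
    Y ((X ^ (j + 1)) v) = (4 * (j + 1) * (c + j) : K) • (X ^ j) v := by
  rw [t.lower_raise_pow_of_eigen j hv, h0, map_zero, zero_add]

theorem raise_lower_pow_of_ker (t : SlTriple X Y H) (j : ℕ) (hv : H v = c • v) (h0 : Y v = 0) :
    X (Y ((X ^ j) v)) = (4 * j * (c + j - 1) : K) • (X ^ j) v := by
  cases j with
  | zero => simp [h0]
  | succ j =>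
    rw [t.lower_raise_pow_of_ker j hv h0, map_smul, pow_succ', Module.End.mul_apply]
    push_cast
    ring_nf

/-- The Casimir element of an `sl₂`-triple, normalized so that only `X`, `Y` and `H` enter and it
acts on the lowest weight module of weight `c` by `-c (c - 2)`. -/
def casimir {A : Type*} [Ring A] (X Y H : A) : A := X * Y - H * H + 2 • H

theorem casimir_raise_pow_of_ker (t : SlTriple X Y H) (j : ℕ) (hv : H v = c • v) (h0 : Y v = 0) :
    casimir X Y H ((X ^ j) v) = (-(c * (c - 2))) • (X ^ j) v := by
  simp only [casimir, LinearMap.add_apply, LinearMap.sub_apply, Module.End.mul_apply,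
    LinearMap.smul_apply, t.raise_lower_pow_of_ker j hv h0, t.weight_raise_pow_of_eigen j hv,
    map_smul]
  module

end LowestWeight

section LowestWeightVanishing

variable {K V : Type*} [Field K] [CharZero K] [AddCommGroup V] [Module K V]
  {X Y H : Module.End K V}

theorem lowering_coeff_ne_zero {c : K} {j : ℕ}
    (hc : c + j ≠ 0) : 4 * (j + 1) * (c + j) ≠ 0 :=
  mul_ne_zero (mul_ne_zero (by norm_num) (Nat.cast_add_one_ne_zero j)) hc

theorem pow_eq_zero_of_ker (t : SlTriple X Y H) {N : ℕ} (hN : X ^ N = 0) {v : V} {c : K}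
    (hv : H v = c • v) (h0 : Y v = 0) {j : ℕ} (hj : ∀ i ≥ j, c + i ≠ 0) : (X ^ j) v = 0 := by
  obtain hNj | hjN := le_total N j
  · rw [pow_eq_zero_of_le hNj hN, LinearMap.zero_apply]
  · refine Nat.decreasingInduction' (P := fun i => (X ^ i) v = 0) (fun i _ hji ih => ?_) hjN
      (by rw [hN, LinearMap.zero_apply])
    have h := t.lower_raise_pow_of_ker i hv h0
    rw [ih, map_zero] at h
    exact (smul_eq_zero.1 h.symm).resolve_left (lowering_coeff_ne_zero (hj i hji))

end LowestWeightVanishing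

/-! ### The Fischer decomposition -/

section Fischer

section CommRing

variable {K V : Type*} [CommRing K] [AddCommGroup V] [Module K V] {X Y H : Module.End K V}
  {W : ℕ → Submodule K V}

/-- The degree `k` part of the Fischer decomposition of a graded space `W`: the span of the
vectors `X ^ j h` with `h ∈ W q` killed by `Y` and `2 j + q = k`. -/
def fischer (X Y : Module.End K V) (W : ℕ → Submodule K V) (k : ℕ) : Submodule K V :=
  Submodule.span K {u | ∃ j q, 2 * j + q = k ∧ ∃ h ∈ W q, Y h = 0 ∧ u = (X ^ j) h}

theorem raise_mem_fischer {k : ℕ} {u : V} (hu : u ∈ fischer X Y W k) :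
    X u ∈ fischer X Y W (k + 2) := by
  suffices fischer X Y W k ≤ (fischer X Y W (k + 2)).comap X from this hu
  refine Submodule.span_le.2 ?_
  rintro _ ⟨j, q, hk, h, hW, hY, rfl⟩
  exact Submodule.subset_span ⟨j + 1, q, by omega, h, hW, hY, by
    rw [pow_succ', Module.End.mul_apply]⟩

theorem raise_pow_mem_fischer {k : ℕ} {u : V} (i : ℕ) (hu : u ∈ fischer X Y W k) :
    (X ^ i) u ∈ fischer X Y W (k + 2 * i) := by
  induction i with
  | zero => simpa using hu
  | succ i ih => rw [pow_succ', Module.End.mul_apply]; exact raise_mem_fischer ih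

theorem fischer_le (hX : ∀ k, ∀ v ∈ W k, X v ∈ W (k + 2)) (k : ℕ) : fischer X Y W k ≤ W k := by
  refine Submodule.span_le.2 ?_
  rintro _ ⟨j, q, rfl, h, hW, -, rfl⟩
  induction j with
  | zero => simpa using hW
  | succ j ih =>
    rw [pow_succ', Module.End.mul_apply, show 2 * (j + 1) + q = 2 * j + q + 2 by ring]
    exact hX _ _ ih

theorem le_fischer_of_ker {k : ℕ} (hY : ∀ v ∈ W k, Y v = 0) : W k ≤ fischer X Y W k :=
  fun v hv => Submodule.subset_span ⟨0, k, by omega, v, hv, hY v hv, rfl⟩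

theorem lower_mem_fischer (t : SlTriple X Y H) {c : K}
    (hH : ∀ k, ∀ v ∈ W k, H v = ((k : K) + c) • v) {k : ℕ} {u : V}
    (hu : u ∈ fischer X Y W (k + 2)) : Y u ∈ fischer X Y W k := by
  suffices fischer X Y W (k + 2) ≤ (fischer X Y W k).comap Y from this hu
  refine Submodule.span_le.2 ?_
  rintro _ ⟨j, q, hk, h, hW, hY, rfl⟩
  cases j with
  | zero => simp [hY]
  | succ j =>
    simp only [Submodule.comap_coe, Set.mem_preimage, SetLike.mem_coe,
      t.lower_raise_pow_of_ker j (hH q h hW) hY]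
    exact Submodule.smul_mem _ _ (Submodule.subset_span ⟨j, q, by omega, h, hW, hY, rfl⟩)

end CommRing

variable {K V : Type*} [Field K] [CharZero K] [AddCommGroup V] [Module K V]
  {X Y H : Module.End K V} {W : ℕ → Submodule K V} {c : K}

theorem fischer_le_map_lower (t : SlTriple X Y H) (hH : ∀ k, ∀ v ∈ W k, H v = ((k : K) + c) • v)
    {k : ℕ} (hc : ∀ j q : ℕ, 2 * j + q = k → (q : K) + c + j ≠ 0) :
    fischer X Y W k ≤ (fischer X Y W (k + 2)).map Y := by
  refine Submodule.span_le.2 ?_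
  rintro _ ⟨j, q, hjq, h, hW, hY, rfl⟩
  have hne := lowering_coeff_ne_zero (hc j q hjq)
  refine ⟨(4 * (j + 1) * ((q : K) + c + j))⁻¹ • (X ^ (j + 1)) h,
    Submodule.smul_mem _ _ (Submodule.subset_span ⟨j + 1, q, by omega, h, hW, hY, rfl⟩), ?_⟩
  rw [map_smul, t.lower_raise_pow_of_ker j (hH q h hW) hY, smul_smul, inv_mul_cancel₀ hne,
    one_smul]

theorem le_fischer_add_two (t : SlTriple X Y H) (hH : ∀ k, ∀ v ∈ W k, H v = ((k : K) + c) • v)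
    (hX : ∀ k, ∀ v ∈ W k, X v ∈ W (k + 2)) {k : ℕ} (hY : ∀ v ∈ W (k + 2), Y v ∈ fischer X Y W k)
    (hc : ∀ j q : ℕ, 2 * j + q = k → (q : K) + c + j ≠ 0) :
    W (k + 2) ≤ fischer X Y W (k + 2) := by
  intro v hv
  obtain ⟨u, hu, huv⟩ := t.fischer_le_map_lower hH hc (hY v hv)
  have hvu : v - u ∈ fischer X Y W (k + 2) :=
    Submodule.subset_span ⟨0, k + 2, by omega, v - u,
      sub_mem hv (fischer_le hX _ hu), by rw [map_sub, huv, sub_self], rfl⟩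
  simpa using add_mem hvu hu

theorem le_fischer_add_two_of_nilpotent (t : SlTriple X Y H)
    (hH : ∀ k, ∀ v ∈ W k, H v = ((k : K) + c) • v) {N : ℕ} (hN : X ^ N = 0) {k : ℕ}
    (hY : ∀ v ∈ W (k + 2), Y v ∈ fischer X Y W k)
    (hc : ∀ i : ℕ, ((k + 2 : ℕ) : K) + c + i ≠ 0) :
    W (k + 2) ≤ fischer X Y W (k + 2) := by
  intro v hv
  suffices (X ^ 0) v ∈ fischer X Y W (k + 2 + 2 * 0) by simpa using this
  refine Nat.decreasingInduction' (P := fun i => (X ^ i) v ∈ fischer X Y W (k + 2 + 2 * i))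
    (fun i _ _ ih => ?_) N.zero_le (by simp [hN])
  have hXY : (X ^ (i + 1)) (Y v) ∈ fischer X Y W (k + 2 + 2 * i) := by
    have := raise_pow_mem_fischer (i + 1) (hY v hv)
    rwa [show k + 2 * (i + 1) = k + 2 + 2 * i by ring] at this
  have hdiff := sub_mem (t.lower_mem_fischer (k := k + 2 + 2 * i) hH ih) hXY
  rw [t.lower_raise_pow_of_eigen i (hH _ v hv), add_sub_cancel_left] at hdiff
  exact (Submodule.smul_mem_iff _ (lowering_coeff_ne_zero (hc i))).1 hdiff

end Fischer

/-! ### Triples from Weyl algebras and tensor products -/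

section Weyl

variable {A ι : Type*} [Ring A] {x d : ι → A}

theorem euler_term_mul_sq [DecidableEq ι] (hxx : ∀ i j, Commute (x i) (x j))
    (hdx : ∀ i j, d i * x j = x j * d i + if i = j then 1 else 0) (i j : ι) :
    x i * d i * (x j * x j) = x j * x j * (x i * d i) + if i = j then 2 • (x j * x j) else 0 := by
  have hd : d i * (x j * x j) = x j * x j * d i + if i = j then 2 • x j else 0 := by
    rw [← mul_assoc, hdx, add_mul, mul_assoc, hdx]
    split_ifs <;> noncomm_ring
  rw [mul_assoc, hd, mul_add, ← mul_assoc, ((hxx i j).mul_right (hxx i j)).eq, mul_assoc]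
  split_ifs with h
  · rw [h, mul_smul_comm]
  · rw [mul_zero]

theorem sq_deriv_mul_sq [DecidableEq ι]
    (hdx : ∀ i j, d i * x j = x j * d i + if i = j then 1 else 0) (i j : ι) :
    d i * d i * (x j * x j)
      = x j * x j * (d i * d i) + if i = j then 4 • (x i * d i) + 2 • 1 else 0 := by
  have hd : d i * (x j * x j) = x j * x j * d i + if i = j then 2 • x j else 0 := by
    rw [← mul_assoc, hdx, add_mul, mul_assoc, hdx]
    split_ifs <;> noncomm_ring
  rw [mul_assoc, hd, mul_add, ← mul_assoc, hd, add_mul, mul_assoc, add_assoc]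
  split_ifs with h
  · rw [h, mul_smul_comm, hdx, if_pos rfl]
    noncomm_ring
  · rw [zero_mul, mul_zero, add_zero]

theorem of_weyl [Fintype ι] [DecidableEq ι] {K : Type*} [Field K] [CharZero K] [Algebra K A]
    (hxx : ∀ i j, Commute (x i) (x j))
    (hdx : ∀ i j, d i * x j = x j * d i + if i = j then 1 else 0) :
    SlTriple (∑ i, x i * x i) (∑ i, d i * d i)
      ((∑ i, x i * d i) + ((Fintype.card ι : K) / 2) • (1 : A)) where
  weight_mul_raise := by
    have euler_mul : (∑ i, x i * d i) * (∑ i, x i * x i)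
        = (∑ i, x i * x i) * (∑ i, x i * d i) + 2 • ∑ i, x i * x i := by
      rw [Finset.sum_mul_sum, Finset.sum_mul_sum, Finset.sum_comm, Finset.smul_sum,
        ← Finset.sum_add_distrib]
      simp only [euler_term_mul_sq hxx hdx, Finset.sum_add_distrib, Finset.sum_ite_eq',
        Finset.mem_univ, if_true]
    rw [add_mul, euler_mul, mul_add, smul_mul_assoc, one_mul, mul_smul_comm, mul_one]
    abel
  lower_mul_raise := by
    rw [Finset.sum_mul_sum, Finset.sum_mul_sum, Finset.sum_comm]
    simp only [sq_deriv_mul_sq hdx, Finset.sum_add_distrib, Finset.sum_ite_eq', Finset.mem_univ,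
      if_true, ← Finset.smul_sum, Finset.sum_const, Finset.card_univ]
    module

theorem sum_deriv_sub_sq [Fintype ι] {K : Type*} [Field K] [CharZero K] [Algebra K A]
    (hdx : ∀ i, d i * x i = x i * d i + 1) :
    ∑ i, (d i - x i) * (d i - x i)
      = (∑ i, d i * d i) - (2 : K) • ((∑ i, x i * d i) + ((Fintype.card ι : K) / 2) • (1 : A))
        + ∑ i, x i * x i := by
  have hterm (i : ι) :
      (d i - x i) * (d i - x i) = d i * d i - (2 • (x i * d i) + 1) + x i * x i := by
    rw [sub_mul, mul_sub, mul_sub, hdx]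
    noncomm_ring
  simp only [hterm, Finset.sum_add_distrib, Finset.sum_sub_distrib, ← Finset.smul_sum,
    Finset.sum_const, Finset.card_univ]
  module

end Weyl

theorem tensor {K V W : Type*} [CommRing K] [AddCommGroup V] [Module K V] [AddCommGroup W]
    [Module K W] {X Y H : Module.End K V} {X' Y' H' : Module.End K W} (t : SlTriple X Y H)
    (t' : SlTriple X' Y' H') :
    SlTriple (LinearMap.rTensor W X + LinearMap.lTensor V X')
      (LinearMap.rTensor W Y + LinearMap.lTensor V Y')
      (LinearMap.rTensor W H + LinearMap.lTensor V H') := by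
  constructor <;> refine TensorProduct.ext' fun v w => ?_ <;>
  · simp only [Module.End.mul_apply, LinearMap.add_apply, LinearMap.smul_apply,
      LinearMap.rTensor_tmul, LinearMap.lTensor_tmul, map_add, t.weight_raise, t'.weight_raise,
      t.lower_raise, t'.lower_raise, TensorProduct.add_tmul, TensorProduct.tmul_add,
      TensorProduct.tmul_smul, ← TensorProduct.smul_tmul']
    module

end SlTriple

theorem sum_mul_pow_div_factorial {A : Type*} [Ring A] [Algebra ℚ A] {x : A} {N : ℕ}
    (hx : x ^ N = 0) : ∑ j ∈ Finset.range (N + 1), ((j : ℚ) * (j.factorial : ℚ)⁻¹) • x ^ j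
      = IsNilpotent.exp x * x := by
  rw [Finset.sum_range_succ', IsNilpotent.exp_eq_sum hx, Finset.sum_mul]
  simp only [Nat.cast_zero, zero_mul, zero_smul, add_zero, smul_mul_assoc, ← pow_succ]
  refine Finset.sum_congr rfl fun j _ => ?_
  have := Nat.cast_add_one_ne_zero (R := ℚ) j
  rw [Nat.factorial_succ]
  push_cast
  field_simp

namespace SlTriple

variable {A : Type*} [Ring A] [Algebra ℚ A] {X Y H : A}

theorem lower_mul_smul_pow (t : SlTriple X Y H) (a : ℚ) (j : ℕ) :
    Y * (a • X) ^ (j + 1) = (a • X) ^ (j + 1) * Y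
      + (j + 1 : ℚ) • ((a • X) ^ j * ((4 * a) • H) + (4 * a * j) • (a • X) ^ j) := by
  simp only [smul_pow, mul_smul_comm, smul_mul_assoc, t.lower_mul_raise_pow]
  module

theorem lower_mul_smul_pow_div_factorial (t : SlTriple X Y H) (a : ℚ) (j : ℕ) :
    Y * (((j + 1).factorial : ℚ)⁻¹ • (a • X) ^ (j + 1))
      = (((j + 1).factorial : ℚ)⁻¹ • (a • X) ^ (j + 1)) * Y
        + (((j.factorial : ℚ)⁻¹ • (a • X) ^ j) * ((4 * a) • H)
          + (4 * a) • ((j : ℚ) * (j.factorial : ℚ)⁻¹) • (a • X) ^ j) := by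
  have hj : ((j + 1).factorial : ℚ)⁻¹ * (j + 1) = (j.factorial : ℚ)⁻¹ := by
    have := Nat.cast_add_one_ne_zero (R := ℚ) j
    rw [Nat.factorial_succ]
    push_cast
    field_simp
  rw [mul_smul_comm, t.lower_mul_smul_pow, smul_add, smul_smul, hj, smul_mul_assoc,
    smul_mul_assoc]
  module

theorem lower_mul_exp (t : SlTriple X Y H) (hX : IsNilpotent X) (a : ℚ) :
    Y * IsNilpotent.exp (a • X)
      = IsNilpotent.exp (a • X) * (Y + (4 * a) • H + (4 * a ^ 2) • X) := by
  obtain ⟨N, hN⟩ := hX.smul a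
  have hN' : (a • X) ^ (N + 1) = 0 := pow_eq_zero_of_le N.le_succ hN
  have hE := IsNilpotent.exp_eq_sum (pow_eq_zero_of_le (N + 1).le_succ hN')
  calc Y * IsNilpotent.exp (a • X)
      = ∑ j ∈ Finset.range (N + 1), Y * (((j + 1).factorial : ℚ)⁻¹ • (a • X) ^ (j + 1)) + Y := by
        rw [hE, Finset.sum_range_succ', mul_add, Finset.mul_sum]
        simp
    _ = (∑ j ∈ Finset.range (N + 1), ((j + 1).factorial : ℚ)⁻¹ • (a • X) ^ (j + 1) + 1) * Y
        + ((∑ j ∈ Finset.range (N + 1), (j.factorial : ℚ)⁻¹ • (a • X) ^ j) * ((4 * a) • H)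
          + (4 * a) • ∑ j ∈ Finset.range (N + 1), ((j : ℚ) * (j.factorial : ℚ)⁻¹) • (a • X) ^ j)
        := by
        simp only [t.lower_mul_smul_pow_div_factorial, Finset.sum_add_distrib, Finset.sum_mul,
          Finset.smul_sum, add_mul, one_mul]
        abel
    _ = IsNilpotent.exp (a • X) * Y + (IsNilpotent.exp (a • X) * ((4 * a) • H)
          + (4 * a) • (IsNilpotent.exp (a • X) * (a • X))) := by
        rw [sum_mul_pow_div_factorial hN, ← IsNilpotent.exp_eq_sum hN', hE,
          Finset.sum_range_succ' _ (N + 1)]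
        simp
    _ = IsNilpotent.exp (a • X) * (Y + (4 * a) • H + (4 * a ^ 2) • X) := by
        simp only [mul_add, mul_smul_comm]
        module

end SlTriple

/-! ### Operators acting by scalars on joint eigenspaces -/

section JointEigenspaces

variable {ι T K V : Type*} [Field K] [AddCommGroup V] [Module K V] {A : ι → Module.End K V}
  {χ : T → ι → K} {U : T → Submodule K V}

theorem commute_of_iSup_eigenspaces (hU : ⨆ t, U t = ⊤)
    (hA : ∀ t, ∀ u ∈ U t, ∀ i, A i u = χ t i • u) (i j : ι) : Commute (A i) (A j) := by
  refine LinearMap.ext fun v => ?_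
  have hv : v ∈ ⨆ t, U t := hU ▸ Submodule.mem_top
  induction hv using Submodule.iSup_induction' with
  | mem t u hu => simp only [Module.End.mul_apply, hA t u hu, map_smul, smul_smul, mul_comm]
  | zero => simp
  | add u v _ _ hu hv => rw [map_add, map_add, hu, hv]

theorem iSupIndep_of_joint_eigenspaces (hcomm : ∀ i j, Commute (A i) (A j))
    (hχ : Function.Injective χ) (hA : ∀ t, ∀ u ∈ U t, ∀ i, A i u = χ t i • u) : iSupIndep U := by
  have hind := Module.End.independent_iInf_maxGenEigenspace_of_forall_mapsTo A
    fun i j φ => Module.End.mapsTo_maxGenEigenspace_of_comm (hcomm j i) φ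
  refine (hind.comp hχ).mono fun t u hu => (Submodule.mem_iInf _).2 fun i => ?_
  exact (Module.End.mem_maxGenEigenspace _ _ _).2 ⟨1, by simp [hA t u hu i]⟩

theorem exists_end_eq_smul_of_iSupIndep (hind : iSupIndep U) (hU : ⨆ t, U t = ⊤) (c : T → K) :
    ∃ S : Module.End K V, ∀ t, ∀ u ∈ U t, S u = c t • u := by
  classical
  let e := LinearEquiv.ofBijective (DirectSum.coeLinearMap U)
    (DirectSum.isInternal_submodule_of_iSupIndep_of_iSup_eq_top hind hU)
  refine ⟨(DirectSum.toModule K T V fun t => c t • (U t).subtype) ∘ₗ e.symm.toLinearMap,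
    fun t u hu => ?_⟩
  have he : e.symm u = DirectSum.lof K T (fun t => U t) t ⟨u, hu⟩ := by
    rw [LinearEquiv.symm_apply_eq]
    exact (DirectSum.coeLinearMap_lof U t ⟨u, hu⟩).symm
  simp [he]

end JointEigenspaces

/-! ### Exterior and Clifford algebras -/

section Clifford

variable {R M : Type*} [CommRing R] [AddCommGroup M] [Module R M] {Q : QuadraticForm R M}

open CliffordAlgebra

theorem contractLeft_mul (d : Module.Dual R M) (a b : CliffordAlgebra Q) :
    contractLeft d (a * b) = contractLeft d a * b + involute a * contractLeft d b := by
  induction a using CliffordAlgebra.left_induction with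
  | algebraMap r => simp [contractLeft_algebraMap, contractLeft_algebraMap_mul]
  | add x y hx hy => simp only [map_add, add_mul, hx, hy]; abel
  | ι_mul x v hx =>
    simp only [mul_assoc, contractLeft_ι_mul, hx, map_mul, involute_ι, mul_add, sub_mul,
      smul_mul_assoc, neg_mul]
    abel

theorem involute_contractLeft (d : Module.Dual R M) (a : CliffordAlgebra Q) :
    involute (contractLeft d a) = -contractLeft d (involute a) := by
  induction a using CliffordAlgebra.left_induction with
  | algebraMap r => simp [contractLeft_algebraMap]
  | add x y hx hy => simp only [map_add, hx, hy, neg_add]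
  | ι_mul x v hx => simp [contractLeft_ι_mul, hx]

end Clifford

section Exterior

variable {R M : Type*} [CommRing R] [AddCommGroup M] [Module R M]

open ExteriorAlgebra

theorem ι_mul_ι_swap (v w : M) : ι R v * ι R w = -(ι R w * ι R v) :=
  eq_neg_of_add_eq_zero_left (ι_add_mul_swap v w)

theorem commute_ι_mul_ι (v w : M) (a : ExteriorAlgebra R M) : Commute (ι R v * ι R w) a := by
  induction a using CliffordAlgebra.left_induction with
  | algebraMap r => exact (Algebra.commutes r _).symm
  | add x y hx hy => exact hx.add_right hy
  | ι_mul x u hx =>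
    refine Commute.mul_right ?_ hx
    change ι R v * ι R w * ι R u = ι R u * (ι R v * ι R w)
    rw [mul_assoc, ι_mul_ι_swap w, mul_neg, ← mul_assoc, ι_mul_ι_swap v, neg_mul, neg_neg,
      mul_assoc]

theorem ι_mul_mem_exteriorPower (v : M) {q : ℕ} {a : ExteriorAlgebra R M} (ha : a ∈ ⋀[R]^q M) :
    ι R v * a ∈ ⋀[R]^(q + 1) M := by
  rw [exteriorPower, pow_succ']
  exact Submodule.mul_mem_mul (LinearMap.mem_range_self _ v) ha

theorem map_mem_exteriorPower (f : M →ₗ[R] M) {q : ℕ} {a : ExteriorAlgebra R M}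
    (ha : a ∈ ⋀[R]^q M) : ExteriorAlgebra.map f a ∈ ⋀[R]^q M := by
  have hle : (⋀[R]^q M).map (ExteriorAlgebra.map f).toLinearMap ≤ ⋀[R]^q M := by
    rw [exteriorPower, Submodule.map_pow, ι_range_map_map]
    exact pow_le_pow_left' LinearMap.map_le_range q
  exact hle (Submodule.mem_map_of_mem ha)

theorem contractLeft_map (f : M →ₗ[R] M) (d : Module.Dual R M) (a : ExteriorAlgebra R M) :
    CliffordAlgebra.contractLeft d (ExteriorAlgebra.map f a)
      = ExteriorAlgebra.map f (CliffordAlgebra.contractLeft (d ∘ₗ f) a) := by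
  induction a using CliffordAlgebra.left_induction with
  | algebraMap r => simp [CliffordAlgebra.contractLeft_algebraMap]
  | add x y hx hy => simp only [map_add, hx, hy]
  | ι_mul x v hx =>
    change CliffordAlgebra.contractLeft d (ExteriorAlgebra.map f (ι R v * x)) = _
    rw [map_mul, map_apply_ι, ι, CliffordAlgebra.contractLeft_ι_mul, hx,
      CliffordAlgebra.contractLeft_ι_mul, map_sub, map_smul, map_mul, ← ι, map_apply_ι]
    rfl

theorem contractLeft_eq_zero_of_mem_zero (d : Module.Dual R M) {a : ExteriorAlgebra R M}
    (ha : a ∈ ⋀[R]^0 M) : CliffordAlgebra.contractLeft d a = 0 := by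
  rw [exteriorPower, pow_zero] at ha
  obtain ⟨r, rfl⟩ := Submodule.mem_one.1 ha
  exact CliffordAlgebra.contractLeft_algebraMap _ _ _

theorem contractLeft_mem_exteriorPower (d : Module.Dual R M) {q : ℕ} {a : ExteriorAlgebra R M}
    (ha : a ∈ ⋀[R]^(q + 1) M) : CliffordAlgebra.contractLeft d a ∈ ⋀[R]^q M := by
  suffices ∀ r (a : ExteriorAlgebra R M), a ∈ ⋀[R]^r M →
      ∀ q, r = q + 1 → CliffordAlgebra.contractLeft d a ∈ ⋀[R]^q M from this _ a ha q rfl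
  intro r a ha
  induction ha using Submodule.pow_induction_on_left' with
  | algebraMap r => intro q hq; omega
  | add x y i _ _ hx hy => intro q hq; rw [map_add]; exact add_mem (hx q hq) (hy q hq)
  | mem_mul w hw i x hx ih =>
    intro q hq
    obtain rfl : i = q := by omega
    obtain ⟨v, rfl⟩ := hw
    rw [ι, CliffordAlgebra.contractLeft_ι_mul]
    refine sub_mem (Submodule.smul_mem _ _ hx) ?_
    cases i with
    | zero => rw [contractLeft_eq_zero_of_mem_zero d hx, mul_zero]; exact zero_mem _
    | succ i => exact ι_mul_mem_exteriorPower v (ih i rfl)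

theorem mul_ι_of_mem_exteriorPower {q : ℕ} {a : ExteriorAlgebra R M} (ha : a ∈ ⋀[R]^q M) (v : M) :
    a * ι R v = (-1 : R) ^ q • (ι R v * a) := by
  induction ha using Submodule.pow_induction_on_left' with
  | algebraMap r => rw [pow_zero, one_smul, Algebra.commutes]
  | add x y i _ _ hx hy => rw [add_mul, hx, hy, mul_add, smul_add]
  | mem_mul w hw i x _ hx =>
    obtain ⟨u, rfl⟩ := hw
    rw [mul_assoc, hx, mul_smul_comm, ← mul_assoc, ι_mul_ι_swap, neg_mul, mul_assoc, pow_succ,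
      mul_smul, neg_one_smul]

theorem reverse_of_mem_exteriorPower {q : ℕ} {a : ExteriorAlgebra R M} (ha : a ∈ ⋀[R]^q M) :
    CliffordAlgebra.reverse a = (-1 : R) ^ q.choose 2 • a := by
  induction ha using Submodule.pow_induction_on_left' with
  | algebraMap r => rw [CliffordAlgebra.reverse.commutes, Nat.choose_zero_succ, pow_zero, one_smul]
  | add x y i _ _ hx hy => rw [map_add, hx, hy, smul_add]
  | mem_mul w hw i x hx ih =>
    obtain ⟨u, rfl⟩ := hw
    rw [CliffordAlgebra.reverse.map_mul, ih, ι, CliffordAlgebra.reverse_ι, smul_mul_assoc, ← ι,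
      mul_ι_of_mem_exteriorPower hx, smul_smul, ← pow_add, Nat.choose_succ_succ' i 1,
      Nat.choose_one_right, add_comm]

end Exterior

section AnticommutingProducts

variable {A : Type*} [Ring A] {a : A} {l : List A}

theorem dvd_list_prod_mul_of_anticommute (h : ∀ b ∈ l, b * a = -(a * b)) : a ∣ l.prod * a := by
  induction l with
  | nil => simp
  | cons b l ih =>
    obtain ⟨c, hc⟩ := ih fun b hb => h b (List.mem_cons_of_mem _ hb)
    exact ⟨-(b * c), by
      rw [List.prod_cons, mul_assoc, hc, ← mul_assoc, h b List.mem_cons_self, neg_mul, mul_assoc,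
        mul_neg]⟩

theorem list_prod_mul_eq_zero_of_anticommute (ha : a * a = 0)
    (h : ∀ b ∈ l, b * a = -(a * b)) (hl : a ∈ l) : l.prod * a = 0 := by
  induction l with
  | nil => simp at hl
  | cons b l ih =>
    have h' : ∀ b ∈ l, b * a = -(a * b) := fun b hb => h b (List.mem_cons_of_mem _ hb)
    rw [List.prod_cons, mul_assoc]
    obtain rfl | hl := List.mem_cons.1 hl
    · obtain ⟨c, hc⟩ := dvd_list_prod_mul_of_anticommute h'
      rw [hc, ← mul_assoc, ha, zero_mul]
    · rw [ih h' hl, mul_zero]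

end AnticommutingProducts

/-! ### The Grassmann algebra -/

section Grassmann

open ExteriorAlgebra

variable {n : ℕ}

theorem gDeriv_ι_mul (k : Fin (2 * n)) (v : Fin (2 * n) → ℂ) (a : Grassmann n) :
    gDeriv k (ι ℂ v * a) = v k • a - ι ℂ v * gDeriv k a :=
  CliffordAlgebra.contractLeft_ι_mul _ _ _

theorem gDeriv_gen_mul (k l : Fin (2 * n)) (a : Grassmann n) :
    gDeriv k (gen l * a) = (if k = l then (1 : ℂ) else 0) • a - gen l * gDeriv k a := by
  rw [gen, gDeriv_ι_mul, Pi.single_apply]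

theorem gDeriv_algebraMap (k : Fin (2 * n)) (c : ℂ) :
    gDeriv k (algebraMap ℂ (Grassmann n) c) = 0 :=
  CliffordAlgebra.contractLeft_algebraMap _ _ _

theorem gDeriv_gDeriv_swap (k l : Fin (2 * n)) (a : Grassmann n) :
    gDeriv k (gDeriv l a) = -gDeriv l (gDeriv k a) :=
  CliffordAlgebra.contractLeft_comm _ _ a

theorem ι_eq_sum_smul_gen (v : Fin (2 * n) → ℂ) : ι ℂ v = ∑ k, v k • gen k := by
  conv_lhs => rw [pi_eq_sum_univ' v, map_sum]
  simp only [map_smul, gen]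

theorem eulerF_ι_mul (v : Fin (2 * n) → ℂ) (a : Grassmann n) :
    eulerF n (ι ℂ v * a) = ι ℂ v * a + ι ℂ v * eulerF n a := by
  have hterm (k : Fin (2 * n)) : gen k * gDeriv k (ι ℂ v * a)
      = (v k • gen k) * a + ι ℂ v * (gen k * gDeriv k a) := by
    rw [gDeriv_ι_mul, mul_sub, mul_smul_comm, smul_mul_assoc, ← mul_assoc, gen, ι_mul_ι_swap,
      neg_mul, sub_neg_eq_add, mul_assoc]
  simp only [eulerF, LinearMap.sum_apply, Module.End.mul_apply, LinearMap.mulLeft_apply, hterm,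
    Finset.sum_add_distrib, ← Finset.sum_mul, ← Finset.mul_sum, ← ι_eq_sum_smul_gen]

theorem eulerF_of_mem {q : ℕ} {a : Grassmann n} (ha : a ∈ ⋀[ℂ]^q (Fin (2 * n) → ℂ)) :
    eulerF n a = (q : ℂ) • a := by
  induction ha using Submodule.pow_induction_on_left' with
  | algebraMap r => simp [eulerF, gDeriv_algebraMap]
  | add x y i _ _ hx hy => rw [map_add, hx, hy, smul_add]
  | mem_mul w hw i x _ hx =>
    obtain ⟨v, rfl⟩ := hw
    rw [eulerF_ι_mul, hx, mul_smul_comm]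
    push_cast
    module

theorem lapF_mem {q : ℕ} {a : Grassmann n} (ha : a ∈ ⋀[ℂ]^(q + 2) (Fin (2 * n) → ℂ)) :
    lapF n a ∈ ⋀[ℂ]^q (Fin (2 * n) → ℂ) := by
  simp only [lapF, LinearMap.smul_apply, LinearMap.sum_apply, Module.End.mul_apply]
  exact Submodule.smul_mem _ _ (sum_mem fun j _ =>
    contractLeft_mem_exteriorPower _ (contractLeft_mem_exteriorPower _ ha))

theorem lapF_eq_zero_of_mem_zero {a : Grassmann n} (ha : a ∈ ⋀[ℂ]^0 (Fin (2 * n) → ℂ)) :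
    lapF n a = 0 := by
  simp [lapF, gDeriv, contractLeft_eq_zero_of_mem_zero _ ha]

theorem lapF_eq_zero_of_mem_one {a : Grassmann n} (ha : a ∈ ⋀[ℂ]^1 (Fin (2 * n) → ℂ)) :
    lapF n a = 0 := by
  simp [lapF, gDeriv,
    contractLeft_eq_zero_of_mem_zero _ (contractLeft_mem_exteriorPower _ ha)]

theorem commute_theta2 (a : Grassmann n) : Commute (theta2 n) a :=
  (Commute.sum_left _ _ _ fun _ _ => commute_ι_mul_ι _ _ a).neg_left

theorem isNilpotent_theta2 : IsNilpotent (theta2 n) := by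
  refine IsNilpotent.neg (Commute.isNilpotent_sum (fun j _ => ⟨2, ?_⟩)
    fun i j _ _ => commute_ι_mul_ι _ _ _)
  have hcomm : Commute (gen (odd j) * gen (even j)) (gen (odd j)) := commute_ι_mul_ι _ _ _
  rw [pow_two, ← mul_assoc, hcomm.eq, ← mul_assoc, gen, ι_sq_zero, zero_mul, zero_mul]

theorem odd_ne_even (i j : Fin n) : odd i ≠ even j :=
  fun h => by have := congrArg Fin.val h; simp only [odd, even] at this; omega

theorem odd_inj {i j : Fin n} : odd i = odd j ↔ i = j := by
  simp [odd, Fin.ext_iff]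

theorem even_inj {i j : Fin n} : even i = even j ↔ i = j := by
  simp [even, Fin.ext_iff]

theorem sum_odd_even {A : Type*} [AddCommMonoid A] (f : Fin (2 * n) → A) :
    ∑ k, f k = ∑ j : Fin n, (f (odd j) + f (even j)) := by
  rw [← (finProdFinEquiv (m := n) (n := 2)).trans (finCongr (mul_comm n 2)) |>.sum_comp,
    Fintype.sum_prod_type]
  refine Finset.sum_congr rfl fun j _ => ?_
  rw [Fin.sum_univ_two]
  congr 2 <;> ext <;> simp [odd, even, finProdFinEquiv]; ring

theorem gDeriv_gDeriv_gen_mul_gen (i j : Fin n) (a : Grassmann n) :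
    gDeriv (odd i) (gDeriv (even i) (gen (odd j) * gen (even j) * a))
      = gen (odd j) * gen (even j) * gDeriv (odd i) (gDeriv (even i) a)
        + if i = j then gen (odd i) * gDeriv (odd i) a + gen (even i) * gDeriv (even i) a - a
          else 0 := by
  have h1 : (odd i = even j) = False := eq_false (odd_ne_even i j)
  have h2 : (even i = odd j) = False := eq_false (odd_ne_even j i).symm
  simp only [mul_assoc, gDeriv_gen_mul, h1, h2, odd_inj, even_inj, if_false, zero_smul, zero_sub,
    map_neg, map_sub, map_smul, mul_sub, mul_smul_comm]
  split_ifs with h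
  · subst h
    simp only [one_smul, mul_neg]
    abel
  · simp

/-! ### The fermionic `sl₂`-triple and its Fischer decomposition -/

/-- The weight operator `𝔼 - n` of the fermionic `sl₂`-triple: the Euler operator shifted by half
the superdimension `-2n` of `Λ_{2n}`. -/
def weightF (n : ℕ) : Module.End ℂ (Grassmann n) := eulerF n - (n : ℂ) • 1

theorem eulerF_theta2_mul (a : Grassmann n) :
    eulerF n (theta2 n * a) = theta2 n * eulerF n a + (2 : ℂ) • (theta2 n * a) := by
  have hterm (j : Fin n) : eulerF n (gen (odd j) * (gen (even j) * a))
      = gen (odd j) * (gen (even j) * eulerF n a)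
        + (2 : ℂ) • (gen (odd j) * (gen (even j) * a)) := by
    simp only [gen, eulerF_ι_mul, mul_add]
    module
  simp only [theta2, neg_mul, Finset.sum_mul, map_neg, map_sum, mul_assoc, hterm,
    Finset.sum_add_distrib, ← Finset.smul_sum]
  module

theorem lapF_theta2_mul (a : Grassmann n) :
    lapF n (theta2 n * a) = theta2 n * lapF n a + (4 : ℂ) • weightF n a := by
  simp only [weightF, LinearMap.sub_apply, LinearMap.smul_apply, Module.End.one_apply, lapF,
    eulerF, theta2, neg_mul, Finset.sum_mul, map_neg, map_sum, LinearMap.sum_apply,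
    Module.End.mul_apply, LinearMap.mulLeft_apply, gDeriv_gDeriv_gen_mul_gen]
  rw [sum_odd_even]
  simp only [Finset.sum_add_distrib, Finset.sum_ite_eq', Finset.mem_univ, if_true,
    Finset.mul_sum, mul_smul_comm, Finset.smul_sum, smul_add, smul_sub, Finset.sum_sub_distrib]
  simp only [← Finset.smul_sum, Finset.sum_const, Finset.card_univ, Fintype.card_fin,
    ← Nat.cast_smul_eq_nsmul ℂ]
  module

theorem slTriple_grassmann :
    SlTriple (LinearMap.mulLeft ℂ (theta2 n)) (lapF n) (weightF n) where
  weight_mul_raise := LinearMap.ext fun a => by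
    simp only [weightF, Module.End.mul_apply, LinearMap.mulLeft_apply, LinearMap.add_apply,
      LinearMap.sub_apply, LinearMap.smul_apply, Module.End.one_apply, eulerF_theta2_mul, mul_sub,
      mul_smul_comm]
    module
  lower_mul_raise := LinearMap.ext fun a => by
    simp only [Module.End.mul_apply, LinearMap.mulLeft_apply, LinearMap.add_apply,
      LinearMap.smul_apply, lapF_theta2_mul]
    module

theorem mulLeft_theta2_pow_apply (j : ℕ) (a : Grassmann n) :
    (LinearMap.mulLeft ℂ (theta2 n) ^ j) a = theta2 n ^ j * a := by
  rw [LinearMap.pow_mulLeft, LinearMap.mulLeft_apply]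

theorem isNilpotent_mulLeft_theta2 : IsNilpotent (LinearMap.mulLeft ℂ (theta2 n)) :=
  isNilpotent_theta2.map (Algebra.lmul ℂ (Grassmann n))

theorem weightF_of_mem {q : ℕ} {a : Grassmann n} (ha : a ∈ ⋀[ℂ]^q (Fin (2 * n) → ℂ)) :
    weightF n a = ((q : ℂ) + -(n : ℂ)) • a := by
  rw [weightF, LinearMap.sub_apply, eulerF_of_mem ha, LinearMap.smul_apply, Module.End.one_apply]
  module

theorem theta2_pow_mul_harmonicF_eq_zero {q j : ℕ} (h : n < j + q) {w : Grassmann n}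
    (hw : w ∈ harmonicF n q) : theta2 n ^ j * w = 0 := by
  obtain ⟨N, hN⟩ := isNilpotent_mulLeft_theta2 (n := n)
  rw [← mulLeft_theta2_pow_apply]
  refine slTriple_grassmann.pow_eq_zero_of_ker hN (weightF_of_mem hw.1) hw.2 fun i hi h0 => ?_
  have : q + i = n := by exact_mod_cast show (q + i : ℂ) = n by linear_combination h0
  omega

theorem one_mem_harmonicF : (1 : Grassmann n) ∈ harmonicF n 0 := by
  have hmem : (1 : Grassmann n) ∈ ⋀[ℂ]^0 (Fin (2 * n) → ℂ) := by
    rw [exteriorPower, pow_zero]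
    exact Submodule.one_le.1 le_rfl
  exact ⟨hmem, lapF_eq_zero_of_mem_zero hmem⟩

theorem theta2_pow_eq_zero : theta2 n ^ (n + 1) = 0 := by
  simpa using theta2_pow_mul_harmonicF_eq_zero (j := n + 1) (q := 0) (by omega) one_mem_harmonicF

theorem le_fischer_grassmann (k : ℕ) :
    ⋀[ℂ]^k (Fin (2 * n) → ℂ) ≤ SlTriple.fischer (LinearMap.mulLeft ℂ (theta2 n)) (lapF n)
      (fun q => ⋀[ℂ]^q (Fin (2 * n) → ℂ)) k := by
  have hweight (q : ℕ) (a : Grassmann n) (ha : a ∈ ⋀[ℂ]^q (Fin (2 * n) → ℂ)) :=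
    weightF_of_mem ha
  have hraise (q : ℕ) (a : Grassmann n) (ha : a ∈ ⋀[ℂ]^q (Fin (2 * n) → ℂ)) :
      theta2 n * a ∈ ⋀[ℂ]^(q + 2) (Fin (2 * n) → ℂ) := by
    rw [theta2, neg_mul, Finset.sum_mul]
    refine neg_mem (sum_mem fun j _ => ?_)
    rw [mul_assoc]
    exact ι_mul_mem_exteriorPower _ (ι_mul_mem_exteriorPower _ ha)
  induction k using Nat.twoStepInduction with
  | zero => exact SlTriple.le_fischer_of_ker fun v hv => lapF_eq_zero_of_mem_zero hv
  | one => exact SlTriple.le_fischer_of_ker fun v hv => lapF_eq_zero_of_mem_one hv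
  | more k ih _ =>
    obtain hk | hk := lt_or_ge k n
    · refine slTriple_grassmann.le_fischer_add_two hweight hraise
        (fun v hv => ih (lapF_mem hv)) fun j q hjq h0 => ?_
      have : q + j = n := by exact_mod_cast show (q + j : ℂ) = n by linear_combination h0
      omega
    · obtain ⟨N, hN⟩ := isNilpotent_mulLeft_theta2 (n := n)
      refine slTriple_grassmann.le_fischer_add_two_of_nilpotent hweight hN
        (fun v hv => ih (lapF_mem hv)) fun i h0 => ?_
      have : k + 2 + i = n := by
        push_cast at h0
        exact_mod_cast show (k + 2 + i : ℂ) = n by linear_combination h0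
      omega

theorem span_theta2_pow_mul_harmonicF :
    Submodule.span ℂ {u : Grassmann n | ∃ j q, j + q ≤ n ∧ ∃ w ∈ harmonicF n q,
      u = theta2 n ^ j * w} = ⊤ := by
  refine eq_top_iff.2 fun a _ => ?_
  induction a using DirectSum.Decomposition.inductionOn
    (fun i => ⋀[ℂ]^i (Fin (2 * n) → ℂ)) with
  | zero => exact zero_mem _
  | add a b ha hb => exact add_mem (ha trivial) (hb trivial)
  | @homogeneous k a =>
    refine (Submodule.span_le.2 ?_ : _ ≤ _) (le_fischer_grassmann k a.2)
    rintro _ ⟨j, q, -, w, hw, hY, rfl⟩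
    rw [mulLeft_theta2_pow_apply]
    by_cases hjq : j + q ≤ n
    · exact Submodule.subset_span ⟨j, q, hjq, w, ⟨hw, hY⟩, rfl⟩
    · rw [theta2_pow_mul_harmonicF_eq_zero (by omega) ⟨hw, hY⟩]
      exact zero_mem _

/-! ### The twist and the conjugation on the Grassmann algebra -/

/-- The algebra endomorphism `x̀_{2j-1} ↦ x̀_{2j}`, `x̀_{2j} ↦ -x̀_{2j-1}`; it agrees with `tilde`
up to a sign in each degree, but is multiplicative. -/
def twistHom (n : ℕ) : Grassmann n →ₐ[ℂ] Grassmann n := ExteriorAlgebra.map (genTwist n)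

theorem genTwist_single_odd (j : Fin n) :
    genTwist n (Pi.single (odd j) 1) = Pi.single (even j) 1 := by
  ext k
  simp [genTwist, Pi.single_apply, (odd_ne_even _ _).symm, odd_inj, Finset.sum_apply]

theorem genTwist_single_even (j : Fin n) :
    genTwist n (Pi.single (even j) 1) = -Pi.single (odd j) 1 := by
  ext k
  simp [genTwist, Pi.single_apply, odd_ne_even, even_inj, Finset.sum_apply]

theorem proj_odd_comp_genTwist (j : Fin n) :
    LinearMap.proj (R := ℂ) (odd j) ∘ₗ genTwist n = -LinearMap.proj (even j) :=
  LinearMap.ext fun v => by simp [genTwist, Pi.single_apply, odd_ne_even, odd_inj, Finset.sum_apply]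

theorem proj_even_comp_genTwist (j : Fin n) :
    LinearMap.proj (R := ℂ) (even j) ∘ₗ genTwist n = LinearMap.proj (odd j) :=
  LinearMap.ext fun v => by
    simp [genTwist, Pi.single_apply, (odd_ne_even _ _).symm, even_inj, Finset.sum_apply]

theorem twistHom_theta2 : twistHom n (theta2 n) = theta2 n := by
  simp only [theta2, twistHom, gen, map_neg, map_sum, map_mul, map_apply_ι, genTwist_single_odd,
    genTwist_single_even]
  congr 1
  refine Finset.sum_congr rfl fun j _ => ?_
  rw [mul_neg, ι_mul_ι_swap, neg_neg]

theorem gDeriv_odd_twistHom (j : Fin n) (a : Grassmann n) :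
    gDeriv (odd j) (twistHom n a) = -twistHom n (gDeriv (even j) a) := by
  rw [gDeriv, twistHom, contractLeft_map, proj_odd_comp_genTwist, map_neg, LinearMap.neg_apply,
    map_neg, gDeriv]

theorem gDeriv_even_twistHom (j : Fin n) (a : Grassmann n) :
    gDeriv (even j) (twistHom n a) = twistHom n (gDeriv (odd j) a) := by
  rw [gDeriv, twistHom, contractLeft_map, proj_even_comp_genTwist, gDeriv]

theorem lapF_twistHom (a : Grassmann n) : lapF n (twistHom n a) = twistHom n (lapF n a) := by
  simp only [lapF, LinearMap.smul_apply, LinearMap.sum_apply, Module.End.mul_apply, map_smul,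
    map_sum, gDeriv_even_twistHom, gDeriv_odd_twistHom]
  congr 1
  refine Finset.sum_congr rfl fun j _ => ?_
  rw [gDeriv_gDeriv_swap, map_neg, neg_neg]

theorem twistHom_mem_harmonicF {q : ℕ} {w : Grassmann n} (hw : w ∈ harmonicF n q) :
    twistHom n w ∈ harmonicF n q :=
  ⟨map_mem_exteriorPower _ hw.1,
    (lapF_twistHom w).trans ((congrArg _ hw.2).trans (map_zero _))⟩

theorem tilde_of_mem {q : ℕ} {a : Grassmann n} (ha : a ∈ ⋀[ℂ]^q (Fin (2 * n) → ℂ)) :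
    tilde n a = (-1 : ℂ) ^ q.choose 2 • twistHom n a :=
  reverse_of_mem_exteriorPower (map_mem_exteriorPower _ ha)

theorem gConj_ι_mul (v : Fin (2 * n) → ℂ) (a : Grassmann n) :
    gConj n (ι ℂ v * a) = ι ℂ (fun k => starRingEnd ℂ (v k)) * gConj n a := by
  rw [gConj_mul]
  congr 1
  exact ExteriorAlgebra.lift_ι_apply ℂ (conjGen n) _ v

theorem gConj_gDeriv (k : Fin (2 * n)) (a : Grassmann n) :
    gConj n (gDeriv k a) = gDeriv k (gConj n a) := by
  induction a using CliffordAlgebra.left_induction with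
  | algebraMap r =>
    rw [gDeriv_algebraMap, map_zero, Algebra.algebraMap_eq_smul_one, map_smulₛₗ, gConj_one,
      ← Algebra.algebraMap_eq_smul_one, gDeriv_algebraMap]
  | add x y hx hy => simp only [map_add, hx, hy]
  | ι_mul x v hx =>
    change gConj n (gDeriv k (ι ℂ v * x)) = gDeriv k (gConj n (ι ℂ v * x))
    rw [gDeriv_ι_mul, map_sub, map_smulₛₗ, gConj_ι_mul, gConj_ι_mul, gDeriv_ι_mul, hx]

theorem gConj_lapF (a : Grassmann n) : gConj n (lapF n a) = lapF n (gConj n a) := by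
  simp only [lapF, LinearMap.smul_apply, LinearMap.sum_apply, Module.End.mul_apply, map_smulₛₗ,
    map_sum, gConj_gDeriv]
  simp [Complex.conj_ofNat]

theorem gConj_theta2 : gConj n (theta2 n) = theta2 n := by
  simp only [theta2, map_neg, map_sum, gConj_mul, gConj_gen]

/-! ### The fermionic Gaussian -/

theorem gaussF_eq_exp : gaussF n = IsNilpotent.exp ((-1 / 2 : ℚ) • theta2 n) := by
  rw [IsNilpotent.exp_eq_sum (k := n + 1) (by rw [smul_pow, theta2_pow_eq_zero, smul_zero]), gaussF]
  refine Finset.sum_congr rfl fun j _ => ?_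
  rw [smul_pow, smul_smul, ← Rat.cast_smul_eq_qsmul ℂ]
  congr 1
  push_cast
  rw [div_pow]
  field_simp

theorem isUnit_gaussF : IsUnit (gaussF n) :=
  gaussF_eq_exp ▸ IsNilpotent.isUnit_exp (isNilpotent_theta2.smul _)

theorem mul_gaussF_eq_exp_apply (a : Grassmann n) :
    a * gaussF n = IsNilpotent.exp ((-1 / 2 : ℚ) • LinearMap.mulLeft ℂ (theta2 n)) a := by
  have hexp := IsNilpotent.map_exp ((isNilpotent_theta2 (n := n)).smul (-1 / 2 : ℚ))
    (Algebra.lmul ℂ (Grassmann n))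
  have hsmul : Algebra.lmul ℂ (Grassmann n) ((-1 / 2 : ℚ) • theta2 n)
      = (-1 / 2 : ℚ) • LinearMap.mulLeft ℂ (theta2 n) :=
    LinearMap.ext fun b => smul_mul_assoc _ _ b
  have hcomm : Commute (gaussF n) a := by
    refine Commute.sum_left _ _ _ fun j _ => ?_
    exact ((commute_theta2 a).pow_left j).smul_left _
  rw [← hcomm.eq, ← hsmul, ← hexp, ← gaussF_eq_exp]
  rfl

theorem lapF_mul_gaussF (a : Grassmann n) :
    lapF n (a * gaussF n)
      = (lapF n a - (2 : ℂ) • weightF n a + theta2 n * a) * gaussF n := by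
  rw [mul_gaussF_eq_exp_apply, mul_gaussF_eq_exp_apply, ← Module.End.mul_apply,
    slTriple_grassmann.lower_mul_exp isNilpotent_mulLeft_theta2, Module.End.mul_apply]
  congr 1
  simp only [LinearMap.add_apply, LinearMap.smul_apply, LinearMap.mulLeft_apply,
    ← Rat.cast_smul_eq_qsmul ℂ]
  push_cast
  module

/-! ### The Berezin integral -/

theorem berezin_gDeriv (k : Fin (2 * n)) (a : Grassmann n) : berezin n (gDeriv k a) = 0 := by
  have hprod : (List.ofFn (fun k : Fin (2 * n) => gDeriv (n := n) k)).reverse.prod * gDeriv k = 0 :=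
    list_prod_mul_eq_zero_of_anticommute
      (LinearMap.ext fun a => CliffordAlgebra.contractLeft_contractLeft _ a)
      (fun b hb => by
        obtain ⟨l, rfl⟩ := (List.mem_ofFn' _ _).1 (List.mem_reverse.1 hb)
        exact LinearMap.ext fun a => gDeriv_gDeriv_swap _ _ a)
      (List.mem_reverse.2 ((List.mem_ofFn' _ _).2 ⟨k, rfl⟩))
  have hprod_apply := LinearMap.congr_fun hprod a
  rw [Module.End.mul_apply] at hprod_apply
  simp only [berezin, LinearMap.smul_apply, LinearMap.comp_apply, hprod_apply, map_zero,
    LinearMap.zero_apply, smul_zero]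

theorem berezin_gDeriv_mul (k : Fin (2 * n)) (a b : Grassmann n) :
    berezin n (gDeriv k a * b) = -berezin n (CliffordAlgebra.involute a * gDeriv k b) := by
  have h := congrArg (berezin n) (contractLeft_mul (LinearMap.proj k) a b)
  rw [← gDeriv, berezin_gDeriv, map_add] at h
  exact eq_neg_of_add_eq_zero_left h.symm

theorem berezin_gDeriv_gDeriv_mul (k l : Fin (2 * n)) (a b : Grassmann n) :
    berezin n (gDeriv k (gDeriv l a) * b) = berezin n (a * gDeriv k (gDeriv l b)) := by
  have hinv : CliffordAlgebra.involute (gDeriv l a) = -gDeriv l (CliffordAlgebra.involute a) :=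
    involute_contractLeft _ a
  rw [berezin_gDeriv_mul, hinv, neg_mul, map_neg, neg_neg, berezin_gDeriv_mul,
    CliffordAlgebra.involute_involute, gDeriv_gDeriv_swap, mul_neg, map_neg, neg_neg]

theorem berezin_lapF_mul (a b : Grassmann n) :
    berezin n (lapF n a * b) = berezin n (a * lapF n b) := by
  simp only [lapF, LinearMap.smul_apply, LinearMap.sum_apply, Module.End.mul_apply, map_smul,
    map_sum, smul_mul_assoc, mul_smul_comm, Finset.sum_mul, Finset.mul_sum,
    berezin_gDeriv_gDeriv_mul]

end Grassmann

/-! ### Polynomials in the commuting variables -/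

section Polynomials

open MvPolynomial

variable (m : ℕ)

/-- The Laplace operator `∑ ∂_{x_i}²` on `ℂ[x_1, …, x_m]`. -/
def lapB : Module.End ℂ (MvPolynomial (Fin m) ℂ) :=
  ∑ i : Fin m, (pderiv i).toLinearMap * (pderiv i).toLinearMap

/-- The weight operator `𝔼 + m/2` of the bosonic `sl₂`-triple on `ℂ[x_1, …, x_m]`. -/
def weightB : Module.End ℂ (MvPolynomial (Fin m) ℂ) :=
  (∑ i : Fin m, LinearMap.mulLeft ℂ (X i) * (pderiv i).toLinearMap) + ((m : ℂ) / 2) • 1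

/-- `r² = ∑ x_i²` in `ℂ[x_1, …, x_m]`. -/
def normSqB : MvPolynomial (Fin m) ℂ := ∑ i : Fin m, X i ^ 2

variable {m}

theorem mulLeft_sum_sq {A ι : Type*} [Ring A] [Algebra ℂ A] [Fintype ι] (x : ι → A) :
    LinearMap.mulLeft ℂ (∑ i, x i ^ 2)
      = ∑ i, LinearMap.mulLeft ℂ (x i) * LinearMap.mulLeft ℂ (x i) :=
  LinearMap.ext fun a => by
    simp only [LinearMap.sum_apply, Module.End.mul_apply, LinearMap.mulLeft_apply, Finset.sum_mul,
      pow_two, mul_assoc]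

theorem pderiv_mul_mulLeft_X (i j : Fin m) :
    (pderiv (R := ℂ) i).toLinearMap * LinearMap.mulLeft ℂ (X j)
      = LinearMap.mulLeft ℂ (X j) * (pderiv i).toLinearMap + if i = j then 1 else 0 := by
  refine LinearMap.ext fun p => ?_
  obtain rfl | hij := eq_or_ne i j
  · simp [add_comm, mul_comm]
  · simp [pderiv_X_of_ne hij.symm, hij]

theorem slTriple_poly :
    SlTriple (LinearMap.mulLeft ℂ (normSqB m)) (lapB m) (weightB m) := by
  have h := SlTriple.of_weyl (K := ℂ) (x := fun i : Fin m => LinearMap.mulLeft ℂ (X (R := ℂ) i))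
    (d := fun i : Fin m => (pderiv (R := ℂ) i).toLinearMap)
    (fun i j => LinearMap.ext fun p => mul_left_comm _ _ p) pderiv_mul_mulLeft_X
  rwa [Fintype.card_fin, ← mulLeft_sum_sq] at h

theorem pderiv_eq_zero_of_isHomogeneous_zero {σ R : Type*} [CommSemiring R] {p : MvPolynomial σ R}
    (hp : p.IsHomogeneous 0) (i : σ) : pderiv i p = 0 := by
  rw [totalDegree_eq_zero_iff_eq_C.1 (Nat.le_zero.1 hp.totalDegree_le), pderiv_C]

theorem weightB_of_isHomogeneous {k : ℕ} {p : MvPolynomial (Fin m) ℂ} (hp : p.IsHomogeneous k) :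
    weightB m p = ((k : ℂ) + (m : ℂ) / 2) • p := by
  rw [weightB, LinearMap.add_apply, LinearMap.sum_apply, add_smul, Nat.cast_smul_eq_nsmul,
    ← hp.sum_X_mul_pderiv]
  rfl

theorem isHomogeneous_normSqB : (normSqB m).IsHomogeneous 2 :=
  IsHomogeneous.sum _ _ _ fun i _ => by simpa using (isHomogeneous_X ℂ i).pow 2

theorem le_fischer_poly (hm : 0 < m) (k : ℕ) :
    homogeneousSubmodule (Fin m) ℂ k ≤ SlTriple.fischer (LinearMap.mulLeft ℂ (normSqB m)) (lapB m)
      (homogeneousSubmodule (Fin m) ℂ) k := by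
  induction k using Nat.twoStepInduction with
  | zero =>
    refine SlTriple.le_fischer_of_ker fun p hp => ?_
    simp [lapB, pderiv_eq_zero_of_isHomogeneous_zero hp]
  | one =>
    refine SlTriple.le_fischer_of_ker fun p hp => ?_
    simp [lapB, pderiv_eq_zero_of_isHomogeneous_zero
      (IsHomogeneous.pderiv ((mem_homogeneousSubmodule 1 p).1 hp))]
  | more k ih _ =>
    refine slTriple_poly.le_fischer_add_two (c := (m : ℂ) / 2)
      (fun q p hp => weightB_of_isHomogeneous hp)
      (fun q p hp => add_comm 2 q ▸ isHomogeneous_normSqB.mul hp) (fun p hp => ih ?_)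
      fun j q _ h0 => ?_
    · rw [lapB, LinearMap.sum_apply]
      exact sum_mem fun i _ => ((mem_homogeneousSubmodule _ p).1 hp).pderiv.pderiv
    · have : 2 * q + m + 2 * j = 0 := by
        exact_mod_cast show (2 * q + m + 2 * j : ℂ) = 0 by linear_combination 2 * h0
      omega

theorem span_normSqB_pow_mul_harmonicB (hm : 0 < m) :
    Submodule.span ℂ {u : MvPolynomial (Fin m) ℂ | ∃ j p, ∃ h ∈ harmonicB m p,
      u = normSqB m ^ j * h} = ⊤ := by
  refine eq_top_iff.2 fun a _ => ?_
  rw [← sum_homogeneousComponent a]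
  refine sum_mem fun k _ => ?_
  refine (Submodule.span_le.2 ?_ : _ ≤ _)
    (le_fischer_poly hm k (homogeneousComponent_mem k a))
  rintro _ ⟨j, q, -, h, hh, hY, rfl⟩
  exact Submodule.subset_span ⟨j, q, h, ⟨hh, hY⟩, by
    rw [LinearMap.pow_mulLeft, LinearMap.mulLeft_apply]⟩

theorem sum_pderiv_sub_X_sq :
    ∑ i : Fin m, ((pderiv i).toLinearMap - LinearMap.mulLeft ℂ (X i))
        * ((pderiv i).toLinearMap - LinearMap.mulLeft ℂ (X i))
      = lapB m - (2 : ℂ) • weightB m + LinearMap.mulLeft ℂ (normSqB m) := by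
  rw [normSqB, mulLeft_sum_sq, lapB, weightB]
  have h := SlTriple.sum_deriv_sub_sq (K := ℂ)
    (x := fun i : Fin m => LinearMap.mulLeft ℂ (X (R := ℂ) i))
    (d := fun i : Fin m => (pderiv (R := ℂ) i).toLinearMap) fun i => by
      rw [pderiv_mul_mulLeft_X, if_pos rfl]
  rwa [Fintype.card_fin] at h

end Polynomials

/-! ### Smooth functions and the bosonic Gaussian -/

section Smooth

variable {m : ℕ}

theorem smooth_differentiable (f : smooth m) : Differentiable ℝ f.1 :=
  (show ContDiff ℝ ∞ f.1 from f.2).differentiable (by simp)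

theorem bDeriv_mul (i : Fin m) (f g : smooth m) :
    bDeriv i (f * g) = bDeriv i f * g + f * bDeriv i g := by
  ext x
  change fderiv ℝ (f.1 * g.1) x _ = fderiv ℝ f.1 x _ * g.1 x + f.1 x * fderiv ℝ g.1 x _
  rw [fderiv_mul (smooth_differentiable f x) (smooth_differentiable g x)]
  simp only [_root_.add_apply, _root_.smul_apply, smul_eq_mul]
  ring

theorem bDeriv_coord (i j : Fin m) : bDeriv i (coord j) = if i = j then 1 else 0 := by
  ext x
  change fderiv ℝ (Complex.ofRealCLM.comp (EuclideanSpace.proj (𝕜 := ℝ) j)) x _ = _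
  rw [ContinuousLinearMap.fderiv]
  split_ifs with hij
  · subst hij
    simp
  · simp [Ne.symm hij]

theorem bDeriv_gaussB (i : Fin m) : bDeriv i (gaussB m) = -(coord i * gaussB m) := by
  ext x
  change fderiv ℝ (fun x : EuclideanSpace ℝ (Fin m) =>
    ((Real.exp (-(∑ i, x i ^ 2) / 2) : ℝ) : ℂ)) x _ = -(((x i : ℝ) : ℂ) * ((Real.exp _ : ℝ) : ℂ))
  have hgauss := ((hasStrictFDerivAt_norm_sq x).hasFDerivAt.neg.mul_const (2⁻¹ : ℝ)).exp
  simp only [EuclideanSpace.real_norm_sq_eq, ← div_eq_mul_inv] at hgauss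
  have hgaussC := (Complex.ofRealCLM.hasFDerivAt.comp x hgauss).fderiv
  refine (congrArg (· (EuclideanSpace.single i 1)) hgaussC).trans ?_
  simp [EuclideanSpace.inner_single_right, mul_comm]

theorem bDeriv_one (i : Fin m) : bDeriv i (1 : smooth m) = 0 := by
  simpa using bDeriv_mul i (1 : smooth m) 1

theorem bDeriv_aeval (i : Fin m) (p : MvPolynomial (Fin m) ℂ) :
    bDeriv i (MvPolynomial.aeval coord p) = MvPolynomial.aeval coord (MvPolynomial.pderiv i p) := by
  induction p using MvPolynomial.induction_on with
  | C a =>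
    rw [MvPolynomial.aeval_C, MvPolynomial.pderiv_C, map_zero, Algebra.algebraMap_eq_smul_one,
      map_smul, bDeriv_one, smul_zero]
  | add p q hp hq => simp only [map_add, hp, hq]
  | mul_X p j hp =>
    rw [map_mul, bDeriv_mul, hp, MvPolynomial.aeval_X, bDeriv_coord, Derivation.leibniz, map_add,
      MvPolynomial.pderiv_X, smul_eq_mul, smul_eq_mul, map_mul, map_mul, MvPolynomial.aeval_X,
      Pi.single_apply]
    simp only [eq_comm (a := i)]
    split_ifs <;> simp [mul_comm, add_comm]

theorem bDeriv_aeval_mul_gaussB (i : Fin m) (p : MvPolynomial (Fin m) ℂ) :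
    bDeriv i (MvPolynomial.aeval coord p * gaussB m)
      = MvPolynomial.aeval coord (MvPolynomial.pderiv i p - MvPolynomial.X i * p) * gaussB m := by
  rw [bDeriv_mul, bDeriv_aeval, bDeriv_gaussB, map_sub, map_mul, MvPolynomial.aeval_X]
  ring

theorem sum_bDeriv_sq_aeval_mul_gaussB (p : MvPolynomial (Fin m) ℂ) :
    (∑ i : Fin m, bDeriv i * bDeriv i) (MvPolynomial.aeval coord p * gaussB m)
      = MvPolynomial.aeval coord (lapB m p - (2 : ℂ) • weightB m p + normSqB m * p)
        * gaussB m := by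
  have hconj := LinearMap.congr_fun (sum_pderiv_sub_X_sq (m := m)) p
  simp only [LinearMap.add_apply, LinearMap.sub_apply, LinearMap.smul_apply,
    LinearMap.mulLeft_apply] at hconj
  rw [← hconj]
  simp only [LinearMap.sum_apply, Module.End.mul_apply, bDeriv_aeval_mul_gaussB, map_sum,
    Finset.sum_mul]
  rfl

theorem isUnit_gaussB : IsUnit (gaussB m) := by
  refine IsUnit.of_mul_eq_one (⟨fun x => ((Real.exp ((∑ i, x i ^ 2) / 2) : ℝ) : ℂ), ?_⟩) ?_
  · change ContDiff ℝ ∞ _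
    refine Complex.ofRealCLM.contDiff.comp (Real.contDiff_exp.comp (ContDiff.div_const
      (ContDiff.sum fun i _ => ?_) _))
    exact (EuclideanSpace.proj (𝕜 := ℝ) i).contDiff.pow 2
  · ext x
    change ((Real.exp (-(∑ i, x i ^ 2) / 2) : ℝ) : ℂ) * ((Real.exp ((∑ i, x i ^ 2) / 2) : ℝ) : ℂ)
      = 1
    rw [← Complex.ofReal_mul, ← Real.exp_add, neg_div, neg_add_cancel, Real.exp_zero,
      Complex.ofReal_one]

theorem aeval_coord_apply (p : MvPolynomial (Fin m) ℂ) (x : EuclideanSpace ℝ (Fin m)) :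
    (MvPolynomial.aeval coord p : smooth m).1 x
      = MvPolynomial.eval (fun i => ((x i : ℝ) : ℂ)) p := by
  induction p using MvPolynomial.induction_on with
  | C a => rw [MvPolynomial.aeval_C, MvPolynomial.eval_C]; rfl
  | add p q hp hq => rw [map_add, map_add, ← hp, ← hq]; rfl
  | mul_X p j hp =>
    rw [map_mul, map_mul, ← hp, MvPolynomial.aeval_X, MvPolynomial.eval_X]
    rfl

theorem aeval_coord_injective :
    Function.Injective (MvPolynomial.aeval (R := ℂ) (coord (m := m))) := by
  intro p q hpq
  refine MvPolynomial.funext_set (fun _ => Set.range ((↑) : ℝ → ℂ))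
    (fun _ => Set.infinite_range_of_injective Complex.ofReal_injective) fun x hx => ?_
  choose y hy using fun i => hx i trivial
  obtain rfl : (fun i => ((y i : ℝ) : ℂ)) = x := funext hy
  have h := congrArg (fun f : smooth m => f.1 (WithLp.toLp 2 y)) hpq
  simpa only [aeval_coord_apply] using h

theorem slTriple_smooth :
    SlTriple (LinearMap.mulLeft ℂ (∑ i : Fin m, coord i ^ 2)) (∑ i : Fin m, bDeriv i * bDeriv i)
      ((∑ i : Fin m, LinearMap.mulLeft ℂ (coord i) * bDeriv i) + ((m : ℂ) / 2) • 1) := by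
  have hdx (i j : Fin m) : bDeriv i * LinearMap.mulLeft ℂ (coord j)
      = LinearMap.mulLeft ℂ (coord j) * bDeriv i + if i = j then 1 else 0 := by
    refine LinearMap.ext fun f => ?_
    rw [Module.End.mul_apply, LinearMap.mulLeft_apply, bDeriv_mul, bDeriv_coord, add_comm]
    split_ifs <;> simp
  have h := SlTriple.of_weyl (K := ℂ) (x := fun i : Fin m => LinearMap.mulLeft ℂ (coord i))
    (d := fun i : Fin m => bDeriv i) (fun i j => LinearMap.ext fun f => mul_left_comm _ _ f) hdx
  rwa [Fintype.card_fin, ← mulLeft_sum_sq] at h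

theorem bConj_mul (f g : smooth m) : bConj m (f * g) = bConj m f * bConj m g := by
  ext x
  exact map_mul (starRingEnd ℂ) (f.1 x) (g.1 x)

theorem bConj_coord (i : Fin m) : bConj m (coord i) = coord i := by
  ext x
  exact Complex.conj_ofReal _

theorem bConj_gaussB : bConj m (gaussB m) = gaussB m := by
  ext x
  exact Complex.conj_ofReal _

theorem bConj_bDeriv (i : Fin m) (f : smooth m) :
    bConj m (bDeriv i f) = bDeriv i (bConj m f) := by
  ext x
  have h := (Complex.conjCLE.toContinuousLinearMap.hasFDerivAt (x := f.1 x)).comp x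
    (smooth_differentiable f x).hasFDerivAt
  exact (DFunLike.congr_fun h.fderiv (EuclideanSpace.single i 1)).symm

theorem bConj_aeval (p : MvPolynomial (Fin m) ℂ) :
    bConj m (MvPolynomial.aeval coord p)
      = MvPolynomial.aeval coord (MvPolynomial.map (starRingEnd ℂ) p) := by
  induction p using MvPolynomial.induction_on with
  | C a => rw [MvPolynomial.map_C, MvPolynomial.aeval_C, MvPolynomial.aeval_C]; rfl
  | add p q hp hq => simp only [map_add, hp, hq]
  | mul_X p j hp =>
    rw [map_mul, bConj_mul, hp, map_mul, map_mul, MvPolynomial.map_X, MvPolynomial.aeval_X,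
      bConj_coord]

end Smooth

/-! ### The coefficients of the polynomials `f_{k,p,q}` -/

theorem descPochhammer_eval_add (k : ℕ) (x y : ℝ) :
    (descPochhammer ℝ k).eval (x + y) = ∑ s ∈ Finset.range (k + 1),
      k.choose s * ((descPochhammer ℝ s).eval x * (descPochhammer ℝ (k - s)).eval y) := by
  have hsmeval (j : ℕ) (z : ℝ) :
      (descPochhammer ℤ j).smeval z = (descPochhammer ℝ j).eval z := by
    rw [← Polynomial.aeval_eq_smeval, ← descPochhammer_map (algebraMap ℤ ℝ),
      Polynomial.eval_map_algebraMap]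
  simpa only [hsmeval, Finset.Nat.sum_antidiagonal_eq_sum_range_succ_mk]
    using Ring.descPochhammer_smeval_add k (Commute.all x y)

theorem Gamma_add_one_eq_descPochhammer_mul {x : ℝ} {s : ℕ} (hs : (s : ℝ) < x + 1) :
    Real.Gamma (x + 1) = (descPochhammer ℝ s).eval x * Real.Gamma (x + 1 - s) := by
  induction s with
  | zero => simp
  | succ s ih =>
    push_cast at hs
    rw [ih (by linarith), descPochhammer_succ_eval, show x + 1 - (s : ℝ) = (x - s) + 1 by ring,
      Real.Gamma_add_one (by linarith)]
    push_cast
    rw [show x + 1 - ((s : ℝ) + 1) = x - s by ring]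
    ring

theorem factorial_add_eq_descPochhammer_mul (l t : ℕ) :
    ((l + t).factorial : ℝ) = (-1) ^ t * (descPochhammer ℝ t).eval (-1 - l : ℝ) * l.factorial := by
  induction t with
  | zero => simp
  | succ t ih =>
    rw [← add_assoc, Nat.factorial_succ, descPochhammer_succ_eval]
    push_cast
    rw [ih]
    ring

/-- The coefficient of `r^{2k-2s} θ^{2s}` in `f_{k,p,q}`. -/
def fCoeff (m n k p q s : ℕ) : ℝ :=
  (k.choose s : ℝ) * (((n - q - s).factorial : ℝ) / Real.Gamma ((m : ℝ) / 2 + p + k - s))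
    * (Real.Gamma ((m : ℝ) / 2 + p + k) / ((n - q - k).factorial : ℝ))

section Coefficients

variable {m n k p q s : ℕ}

theorem fCoeff_eq_descPochhammer (hm : 0 < m) (hs : s ≤ k) (hk : k + q ≤ n) :
    fCoeff m n k p q s = (-1) ^ (k - s) * (k.choose s *
      ((descPochhammer ℝ s).eval ((m : ℝ) / 2 + p + k - 1)
        * (descPochhammer ℝ (k - s)).eval (-1 - (n - q - k : ℕ) : ℝ))) := by
  have hm' : (0 : ℝ) < m := Nat.cast_pos.2 hm
  have hs' : (s : ℝ) ≤ k := Nat.cast_le.2 hs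
  have hGamma := Gamma_add_one_eq_descPochhammer_mul
    (x := (m : ℝ) / 2 + p + k - 1) (s := s) (by linarith)
  have hfactorial := factorial_add_eq_descPochhammer_mul (n - q - k) (k - s)
  rw [show n - q - k + (k - s) = n - q - s by omega] at hfactorial
  rw [sub_add_cancel] at hGamma
  have hGamma_ne : Real.Gamma ((m : ℝ) / 2 + p + k - s) ≠ 0 :=
    (Real.Gamma_pos_of_pos (by linarith)).ne'
  have hfactorial_ne : ((n - q - k).factorial : ℝ) ≠ 0 := by positivity
  rw [fCoeff, hGamma, hfactorial]
  set G := Real.Gamma ((m : ℝ) / 2 + p + k - s)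
  field_simp

theorem sum_neg_one_pow_mul_fCoeff (hm : 0 < m) (hk : k + q ≤ n) :
    ∑ s ∈ Finset.range (k + 1), (-1) ^ s * fCoeff m n k p q s
      = (-1) ^ k * (descPochhammer ℝ k).eval
        (((m : ℝ) / 2 + p + k - 1) + (-1 - (n - q - k : ℕ))) := by
  rw [descPochhammer_eval_add, Finset.mul_sum]
  refine Finset.sum_congr rfl fun s hs => ?_
  have hs' : s ≤ k := Nat.lt_succ_iff.1 (Finset.mem_range.1 hs)
  rw [fCoeff_eq_descPochhammer hm hs' hk, ← mul_assoc, ← pow_add, Nat.add_sub_cancel' hs']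

theorem pos_of_superDim_ne (hM : ∀ k : ℕ, superDim m n ≠ -(2 * k)) : 0 < m := by
  have := hM n
  rw [superDim] at this
  omega

theorem sum_neg_one_pow_mul_fCoeff_ne_zero (hM : ∀ k : ℕ, superDim m n ≠ -(2 * k))
    (hk : k + q ≤ n) : ∑ s ∈ Finset.range (k + 1), (-1) ^ s * fCoeff m n k p q s ≠ 0 := by
  rw [sum_neg_one_pow_mul_fCoeff (pos_of_superDim_ne hM) hk, descPochhammer_eval_eq_prod_range]
  refine mul_ne_zero (pow_ne_zero _ (by norm_num)) (Finset.prod_ne_zero_iff.2 fun i hi hzero => ?_)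
  have hi' : i + 1 ≤ k := Finset.mem_range.1 hi
  refine hM (p + q + 2 * (k - 1) - i) ?_
  have hcast : ((n - q - k : ℕ) : ℝ) = n - q - k := by
    rw [Nat.cast_sub (by omega), Nat.cast_sub (by omega)]
  rw [hcast] at hzero
  have hzero' : ((m + 2 * p + 2 * q + 4 * k : ℤ) : ℝ) = ((2 * n + 4 + 2 * i : ℤ) : ℝ) := by
    push_cast
    linarith
  rw [superDim]
  have := Int.cast_injective hzero'
  omega

theorem choose_mul_sub_eq (hs : s ≤ k) :
    (k.choose s : ℝ) * (k - s) = k.choose (s + 1) * (s + 1) := by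
  rw [← Nat.cast_sub hs]
  exact_mod_cast (Nat.choose_succ_right_eq k s).symm

theorem fCoeff_mul_eq_fCoeff_succ_mul (hm : 0 < m) (hs : s < k) (hk : k + q ≤ n) :
    fCoeff m n k p q s * ((k - s) * ((m : ℝ) / 2 + p + k - s - 1))
      = fCoeff m n k p q (s + 1) * ((s + 1) * (n - q - s)) := by
  have hm' : (0 : ℝ) < m := Nat.cast_pos.2 hm
  have hs' : (s : ℝ) + 1 ≤ k := by exact_mod_cast hs
  have hfactorial : ((n - q - s).factorial : ℝ)
      = (n - q - s) * ((n - q - (s + 1)).factorial : ℝ) := by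
    rw [show n - q - s = n - q - (s + 1) + 1 by omega, Nat.factorial_succ]
    push_cast [Nat.cast_sub (show s + 1 ≤ n - q by omega), Nat.cast_sub (show q ≤ n by omega)]
    ring
  obtain ⟨x, hx⟩ : ∃ x : ℝ, (m : ℝ) / 2 + p + k - s = x + 1 := ⟨_, (sub_add_cancel _ 1).symm⟩
  have hx0 : 0 < x := by linarith
  have hx' : (m : ℝ) / 2 + p + k - (s + 1 : ℕ) = x := by
    push_cast
    linarith
  have hGamma_ne := (Real.Gamma_pos_of_pos hx0).ne'
  rw [fCoeff, fCoeff, hfactorial, hx', hx, Real.Gamma_add_one hx0.ne', add_sub_cancel_right]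
  field_simp
  linear_combination (n - q - s : ℝ) * choose_mul_sub_eq hs.le

end Coefficients

/-! ### The `sl₂`-triple of superpolynomials -/

/-- The super Laplace operator `∇²` on superpolynomials. -/
def lapP (m n : ℕ) : Module.End ℂ (SuperPoly m n) :=
  LinearMap.rTensor (Grassmann n) (lapB m) + LinearMap.lTensor (MvPolynomial (Fin m) ℂ) (lapF n)

/-- The weight operator `𝔼 + M/2` of the `sl₂`-triple on superpolynomials. -/
def weightP (m n : ℕ) : Module.End ℂ (SuperPoly m n) :=
  LinearMap.rTensor (Grassmann n) (weightB m)
    + LinearMap.lTensor (MvPolynomial (Fin m) ℂ) (weightF n)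

section SuperPolynomials

variable {m n : ℕ}

theorem r2_mul_tmul (P : MvPolynomial (Fin m) ℂ) (a : Grassmann n) :
    r2 m n * (P ⊗ₜ a) = (normSqB m * P) ⊗ₜ a := by
  rw [r2, Algebra.TensorProduct.tmul_mul_tmul, one_mul, normSqB]

theorem th2_mul_tmul (P : MvPolynomial (Fin m) ℂ) (a : Grassmann n) :
    th2 m n * (P ⊗ₜ a) = P ⊗ₜ (theta2 n * a) := by
  rw [th2, Algebra.TensorProduct.tmul_mul_tmul, one_mul]

theorem mulLeft_R2 : LinearMap.mulLeft ℂ (R2 m n)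
    = LinearMap.rTensor (Grassmann n) (LinearMap.mulLeft ℂ (normSqB m))
      + LinearMap.lTensor (MvPolynomial (Fin m) ℂ) (LinearMap.mulLeft ℂ (theta2 n)) :=
  TensorProduct.ext' fun P a => by
    rw [LinearMap.mulLeft_apply, R2, add_mul, r2_mul_tmul, th2_mul_tmul]
    rfl

theorem slTriple_superPoly :
    SlTriple (LinearMap.mulLeft ℂ (R2 m n)) (lapP m n) (weightP m n) := by
  rw [mulLeft_R2]
  exact slTriple_poly.tensor slTriple_grassmann

theorem mulLeft_R2_pow_apply (j : ℕ) (P : SuperPoly m n) :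
    (LinearMap.mulLeft ℂ (R2 m n) ^ j) P = R2 m n ^ j * P := by
  rw [LinearMap.pow_mulLeft, LinearMap.mulLeft_apply]

/-- The superpolynomial `r^{2a} θ^{2b} h w`. -/
def radial (h : MvPolynomial (Fin m) ℂ) (w : Grassmann n) (a b : ℕ) : SuperPoly m n :=
  (normSqB m ^ a * h) ⊗ₜ (theta2 n ^ b * w)

variable {h : MvPolynomial (Fin m) ℂ} {w : Grassmann n}

theorem r2_mul_radial (a b : ℕ) : r2 m n * radial h w a b = radial h w (a + 1) b := by
  rw [radial, r2_mul_tmul, radial, pow_succ', mul_assoc]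

theorem th2_mul_radial (a b : ℕ) : th2 m n * radial h w a b = radial h w a (b + 1) := by
  rw [radial, th2_mul_tmul, radial, pow_succ', mul_assoc]

theorem R2_mul_radial (a b : ℕ) :
    R2 m n * radial h w a b = radial h w (a + 1) b + radial h w a (b + 1) := by
  rw [R2, add_mul, r2_mul_radial, th2_mul_radial]

theorem r2_pow_mul_th2_pow_mul_tmul (a b : ℕ) :
    r2 m n ^ a * th2 m n ^ b * (h ⊗ₜ w) = radial h w a b := by
  have hth2 : th2 m n ^ b * (h ⊗ₜ w) = radial h w 0 b := by
    induction b with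
    | zero => simp [radial]
    | succ b ih => rw [pow_succ', mul_assoc, ih, th2_mul_radial]
  rw [mul_assoc, hth2]
  induction a with
  | zero => rw [pow_zero, one_mul]
  | succ a ih => rw [pow_succ', mul_assoc, ih, r2_mul_radial]

theorem fPoly_mul_tmul (k p q : ℕ) :
    fPoly m n k p q * (h ⊗ₜ w)
      = ∑ s ∈ Finset.range (k + 1), ((fCoeff m n k p q s : ℝ) : ℂ) • radial h w (k - s) s := by
  rw [fPoly, Finset.sum_mul]
  exact Finset.sum_congr rfl fun s _ => by
    rw [smul_mul_assoc, r2_pow_mul_th2_pow_mul_tmul, fCoeff]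

variable {p q : ℕ}

theorem weightP_radial (hh : h ∈ harmonicB m p) (hw : w ∈ harmonicF n q) (a b : ℕ) :
    weightP m n (radial h w a b)
      = ((p : ℂ) + q + (m : ℂ) / 2 - n + 2 * (a + b)) • radial h w a b := by
  have hB := slTriple_poly.weight_raise_pow_of_eigen a (weightB_of_isHomogeneous hh.1)
  have hF := slTriple_grassmann.weight_raise_pow_of_eigen b (weightF_of_mem hw.1)
  rw [LinearMap.pow_mulLeft, LinearMap.mulLeft_apply] at hB hF
  rw [weightP, radial, LinearMap.add_apply, LinearMap.rTensor_tmul, LinearMap.lTensor_tmul,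
    hB, hF, ← TensorProduct.smul_tmul', TensorProduct.tmul_smul]
  module

theorem lapB_normSqB_pow_mul (hh : h ∈ harmonicB m p) (a : ℕ) :
    lapB m (normSqB m ^ (a + 1) * h)
      = (4 * (a + 1) * ((p : ℂ) + (m : ℂ) / 2 + a)) • (normSqB m ^ a * h) := by
  have := slTriple_poly.lower_raise_pow_of_ker a (weightB_of_isHomogeneous hh.1) hh.2
  rwa [LinearMap.pow_mulLeft, LinearMap.pow_mulLeft] at this

theorem lapF_theta2_pow_mul (hw : w ∈ harmonicF n q) (b : ℕ) :
    lapF n (theta2 n ^ (b + 1) * w)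
      = (4 * (b + 1) * ((q : ℂ) + -(n : ℂ) + b)) • (theta2 n ^ b * w) := by
  have := slTriple_grassmann.lower_raise_pow_of_ker b (weightF_of_mem hw.1) hw.2
  rwa [LinearMap.pow_mulLeft, LinearMap.pow_mulLeft] at this

theorem weightP_fPoly_mul (hh : h ∈ harmonicB m p) (hw : w ∈ harmonicF n q) (k : ℕ) :
    weightP m n (fPoly m n k p q * (h ⊗ₜ w))
      = ((p : ℂ) + q + (m : ℂ) / 2 - n + 2 * k) • (fPoly m n k p q * (h ⊗ₜ w)) := by
  rw [fPoly_mul_tmul, map_sum, Finset.smul_sum]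
  refine Finset.sum_congr rfl fun s hs => ?_
  have hs' : s ≤ k := Nat.lt_succ_iff.1 (Finset.mem_range.1 hs)
  rw [map_smul, weightP_radial hh hw, smul_comm, Nat.cast_sub hs', sub_add_cancel]

theorem lapP_fPoly_mul (hm : 0 < m) (hh : h ∈ harmonicB m p) (hw : w ∈ harmonicF n q) {k : ℕ}
    (hk : k + q ≤ n) : lapP m n (fPoly m n k p q * (h ⊗ₜ w)) = 0 := by
  have hB : lapB m h = 0 := hh.2
  have hF : lapF n w = 0 := hw.2
  rw [fPoly_mul_tmul, lapP, LinearMap.add_apply, map_sum, map_sum, Finset.sum_range_succ,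
    Finset.sum_range_succ' (fun s => LinearMap.lTensor _ (lapF n) _)]
  simp only [map_smul, radial, LinearMap.rTensor_tmul, LinearMap.lTensor_tmul, Nat.sub_self,
    pow_zero, one_mul, hB, hF, TensorProduct.zero_tmul, TensorProduct.tmul_zero, smul_zero,
    add_zero]
  -- The bosonic part of the `s`-th term cancels the fermionic part of the next one.
  rw [← Finset.sum_add_distrib]
  refine Finset.sum_eq_zero fun s hs => ?_
  have hs' : s < k := Finset.mem_range.1 hs
  rw [lapF_theta2_pow_mul hw, show k - s = (k - (s + 1)) + 1 by omega, lapB_normSqB_pow_mul hh,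
    ← TensorProduct.smul_tmul', TensorProduct.tmul_smul, smul_smul, smul_smul, ← add_smul]
  have hcoeff : ((fCoeff m n k p q s : ℝ) : ℂ) * ((k - s) * ((m : ℂ) / 2 + p + k - s - 1))
      = ((fCoeff m n k p q (s + 1) : ℝ) : ℂ) * ((s + 1) * (n - q - s)) := by
    have := congrArg Complex.ofReal (fCoeff_mul_eq_fCoeff_succ_mul (p := p) hm hs' hk)
    push_cast at this
    exact this
  rw [Nat.cast_sub (show s + 1 ≤ k by omega)]
  convert zero_smul ℂ _ using 2
  push_cast
  linear_combination 4 * hcoeff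

/-- The element `R^{2j} f_{i,p,q} h w` of the super Fischer decomposition. -/
def fischerElt (j i p q : ℕ) (h : MvPolynomial (Fin m) ℂ) (w : Grassmann n) : SuperPoly m n :=
  R2 m n ^ j * fPoly m n i p q * (h ⊗ₜ w)

theorem fischerElt_zero (i : ℕ) : fischerElt 0 i p q h w = fPoly m n i p q * (h ⊗ₜ w) := by
  rw [fischerElt, pow_zero, one_mul]

theorem R2_mul_fischerElt (j i : ℕ) :
    R2 m n * fischerElt j i p q h w = fischerElt (j + 1) i p q h w := by
  rw [fischerElt, fischerElt, pow_succ', mul_assoc, mul_assoc, mul_assoc]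

theorem fischerElt_eq_pow (j i : ℕ) :
    fischerElt j i p q h w
      = (LinearMap.mulLeft ℂ (R2 m n) ^ j) (fPoly m n i p q * (h ⊗ₜ w)) := by
  rw [mulLeft_R2_pow_apply, fischerElt, mul_assoc]

theorem fischerElt_smul_right (j i : ℕ) (c : ℂ) :
    fischerElt j i p q h (c • w) = c • fischerElt j i p q h w := by
  rw [fischerElt, TensorProduct.tmul_smul, mul_smul_comm, fischerElt]

theorem weightP_fischerElt (hh : h ∈ harmonicB m p) (hw : w ∈ harmonicF n q) (j i : ℕ) :
    weightP m n (fischerElt j i p q h w)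
      = ((p : ℂ) + q + (m : ℂ) / 2 - n + 2 * i + 2 * j) • fischerElt j i p q h w := by
  rw [fischerElt_eq_pow, slTriple_superPoly.weight_raise_pow_of_eigen j (weightP_fPoly_mul hh hw i)]

theorem lapP_fischerElt_zero (hm : 0 < m) (hh : h ∈ harmonicB m p) (hw : w ∈ harmonicF n q)
    {i : ℕ} (hi : i + q ≤ n) : lapP m n (fischerElt 0 i p q h w) = 0 := by
  rw [fischerElt_zero, lapP_fPoly_mul hm hh hw hi]

theorem lapP_fischerElt_succ (hm : 0 < m) (hh : h ∈ harmonicB m p) (hw : w ∈ harmonicF n q)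
    (j : ℕ) {i : ℕ} (hi : i + q ≤ n) :
    lapP m n (fischerElt (j + 1) i p q h w)
      = (4 * (j + 1) * ((p : ℂ) + q + (m : ℂ) / 2 - n + 2 * i + j)) • fischerElt j i p q h w := by
  rw [fischerElt_eq_pow, fischerElt_eq_pow,
    slTriple_superPoly.lower_raise_pow_of_ker j (weightP_fPoly_mul hh hw i)
      (lapP_fPoly_mul hm hh hw hi)]

theorem R2_mul_lapP_fischerElt (hm : 0 < m) (hh : h ∈ harmonicB m p) (hw : w ∈ harmonicF n q)
    (j : ℕ) {i : ℕ} (hi : i + q ≤ n) :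
    R2 m n * lapP m n (fischerElt j i p q h w)
      = (4 * j * ((p : ℂ) + q + (m : ℂ) / 2 - n + 2 * i + j - 1)) • fischerElt j i p q h w := by
  rw [fischerElt_eq_pow]
  exact slTriple_superPoly.raise_lower_pow_of_ker j (weightP_fPoly_mul hh hw i)
    (lapP_fPoly_mul hm hh hw hi)

/-! ### The super Fischer decomposition -/

theorem R2_mul_mem_span_fischerElt {u : SuperPoly m n}
    (hu : u ∈ Submodule.span ℂ {u | ∃ j i, i + q ≤ n ∧ u = fischerElt j i p q h w}) :
    R2 m n * u ∈ Submodule.span ℂ {u | ∃ j i, i + q ≤ n ∧ u = fischerElt j i p q h w} := by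
  refine (Submodule.span_le.2 ?_ : _ ≤ (Submodule.span ℂ _).comap
    (LinearMap.mulLeft ℂ (R2 m n))) hu
  rintro _ ⟨j, i, hi, rfl⟩
  exact Submodule.subset_span ⟨j + 1, i, hi, R2_mul_fischerElt j i⟩

theorem radial_sub_mem {D : Submodule ℂ (SuperPoly m n)} {d : ℕ}
    (hD : ∀ s < d, R2 m n * radial h w (d - 1 - s) s ∈ D) {s : ℕ} (hs : s ≤ d) :
    radial h w (d - s) s - (-1 : ℂ) ^ s • radial h w d 0 ∈ D := by
  induction s with
  | zero => simp
  | succ s ih =>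
    have hR := hD s hs
    rw [R2_mul_radial, show d - 1 - s + 1 = d - s by omega] at hR
    have hsub := sub_mem hR (ih (by omega))
    rw [show d - (s + 1) = d - 1 - s by omega, pow_succ]
    convert hsub using 1
    module

theorem radial_mem_of_sub_mem (hM : ∀ k : ℕ, superDim m n ≠ -(2 * k)) (hw : w ∈ harmonicF n q)
    {D : Submodule ℂ (SuperPoly m n)} {d : ℕ}
    (hf : d + q ≤ n → fPoly m n d p q * (h ⊗ₜ w) ∈ D)
    (hsub : ∀ s ≤ d, radial h w (d - s) s - (-1 : ℂ) ^ s • radial h w d 0 ∈ D) :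
    radial h w d 0 ∈ D := by
  by_cases hd : d + q ≤ n
  · -- Modulo `D`, the element `f_{d,p,q} h w` is `r^{2d} h w` times a nonzero number.
    have hsum : ∑ s ∈ Finset.range (d + 1), ((fCoeff m n d p q s : ℝ) : ℂ)
        • (radial h w (d - s) s - (-1 : ℂ) ^ s • radial h w d 0) ∈ D :=
      sum_mem fun s hs => Submodule.smul_mem _ _
        (hsub s (Nat.lt_succ_iff.1 (Finset.mem_range.1 hs)))
    have hmem := sub_mem (hf hd) hsum
    rw [fPoly_mul_tmul, ← Finset.sum_sub_distrib] at hmem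
    simp only [smul_sub, sub_sub_cancel, smul_smul] at hmem
    rw [← Finset.sum_smul] at hmem
    refine (Submodule.smul_mem_iff _ ?_).1 hmem
    have hne := Complex.ofReal_ne_zero.2 (sum_neg_one_pow_mul_fCoeff_ne_zero (p := p) hM hd)
    push_cast at hne
    simpa only [mul_comm] using hne
  · have hmem := hsub d le_rfl
    have hzero : radial h w (d - d) d = 0 := by
      rw [radial, theta2_pow_mul_harmonicF_eq_zero (by omega) hw, TensorProduct.tmul_zero]
    rw [hzero, zero_sub, ← neg_smul] at hmem
    exact (Submodule.smul_mem_iff _ (neg_ne_zero.2 (pow_ne_zero _ (by norm_num)))).1 hmem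

theorem radial_mem_span_fischerElt (hM : ∀ k : ℕ, superDim m n ≠ -(2 * k))
    (hw : w ∈ harmonicF n q) (p a b : ℕ) :
    radial h w a b ∈ Submodule.span ℂ {u | ∃ j i, i + q ≤ n ∧ u = fischerElt j i p q h w} := by
  suffices key : ∀ d, ∀ s ≤ d, radial h w (d - s) s
      ∈ Submodule.span ℂ {u | ∃ j i, i + q ≤ n ∧ u = fischerElt j i p q h w} by
    simpa using key (a + b) b (Nat.le_add_left b a)
  intro d
  induction d using Nat.strong_induction_on with
  | _ d ih =>
    have hf (hd : d + q ≤ n) : fPoly m n d p q * (h ⊗ₜ w)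
        ∈ Submodule.span ℂ {u | ∃ j i, i + q ≤ n ∧ u = fischerElt j i p q h w} :=
      Submodule.subset_span ⟨0, d, hd, (fischerElt_zero d).symm⟩
    have hsub (s : ℕ) := radial_sub_mem (d := d) (s := s) fun s hs =>
      R2_mul_mem_span_fischerElt (ih (d - 1) (by omega) s (by omega))
    have htop := radial_mem_of_sub_mem hM hw hf fun _ => hsub _
    intro s hs
    simpa using add_mem (hsub s hs) (Submodule.smul_mem _ ((-1 : ℂ) ^ s) htop)

theorem span_fischerElt (hM : ∀ k : ℕ, superDim m n ≠ -(2 * k)) :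
    Submodule.span ℂ {u : SuperPoly m n | ∃ j i p q, i + q ≤ n ∧ ∃ h ∈ harmonicB m p,
      ∃ w ∈ harmonicF n q, u = fischerElt j i p q h w} = ⊤ := by
  rw [← top_le_iff, ← TensorProduct.map₂_mk_top_top_eq_top,
    ← span_normSqB_pow_mul_harmonicB (pos_of_superDim_ne hM), ← span_theta2_pow_mul_harmonicF,
    Submodule.map₂_span_span, Submodule.span_le]
  rintro _ ⟨_, ⟨a, p, h, hh, rfl⟩, _, ⟨b, q, -, w, hw, rfl⟩, rfl⟩
  refine Submodule.span_mono ?_ (radial_mem_span_fischerElt (h := h) hM hw p a b)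
  rintro _ ⟨j, i, hi, rfl⟩
  exact ⟨j, i, p, q, hi, h, hh, w, hw, rfl⟩

end SuperPolynomials

section JointSpectrum

variable {m n : ℕ}

/-- The indices `(j, i, p, q)` with `i + q ≤ n` of the super Fischer decomposition. -/
@[ext]
structure FischerIndex (n : ℕ) where
  j : ℕ
  i : ℕ
  p : ℕ
  q : ℕ
  le : i + q ≤ n

/-- The piece of the super Fischer decomposition spanned by the `R^{2j} f_{i,p,q} H^b_p H^f_q`. -/
def fischerPiece (m n : ℕ) (t : FischerIndex n) : Submodule ℂ (SuperPoly m n) :=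
  Submodule.span ℂ {u | ∃ h ∈ harmonicB m t.p, ∃ w ∈ harmonicF n t.q,
    u = fischerElt t.j t.i t.p t.q h w}

/-- The weight, `R² ∇²`, and the Casimir elements of the bosonic and the fermionic `sl₂`-triples:
the operators whose joint eigenspaces are the pieces of the super Fischer decomposition. -/
def fischerOp (m n : ℕ) : Fin 4 → Module.End ℂ (SuperPoly m n) :=
  ![weightP m n,
    LinearMap.mulLeft ℂ (R2 m n) * lapP m n,
    LinearMap.rTensor (Grassmann n)
      (SlTriple.casimir (LinearMap.mulLeft ℂ (normSqB m)) (lapB m) (weightB m)),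
    LinearMap.lTensor (MvPolynomial (Fin m) ℂ)
      (SlTriple.casimir (LinearMap.mulLeft ℂ (theta2 n)) (lapF n) (weightF n))]

/-- The eigenvalues of `fischerOp` on the piece with index `t`. -/
def fischerEigenvalue (m n : ℕ) (t : FischerIndex n) : Fin 4 → ℂ :=
  ![(t.p : ℂ) + t.q + (m : ℂ) / 2 - n + 2 * t.i + 2 * t.j,
    4 * t.j * ((t.p : ℂ) + t.q + (m : ℂ) / 2 - n + 2 * t.i + t.j - 1),
    -(((t.p : ℂ) + (m : ℂ) / 2) * ((t.p : ℂ) + (m : ℂ) / 2 - 2)),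
    -(((t.q : ℂ) + -(n : ℂ)) * ((t.q : ℂ) + -(n : ℂ) - 2))]

theorem int_eqs_of_fischerEigenvalue_eq {t t' : FischerIndex n}
    (h : fischerEigenvalue m n t = fischerEigenvalue m n t') :
    (t.p + t.q + 2 * t.i + 2 * t.j : ℤ) = t'.p + t'.q + 2 * t'.i + 2 * t'.j ∧
    (t.j * (2 * t.p + 2 * t.q + superDim m n + 4 * t.i + 2 * t.j - 2) : ℤ)
      = t'.j * (2 * t'.p + 2 * t'.q + superDim m n + 4 * t'.i + 2 * t'.j - 2) ∧
    ((t.p - t'.p) * (t.p + t'.p + m - 2) : ℤ) = 0 ∧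
    ((t.q - t'.q) * (t.q + t'.q - 2 * n - 2) : ℤ) = 0 := by
  have h0 := congrFun h 0
  have h1 := congrFun h 1
  have h2 := congrFun h 2
  have h3 := congrFun h 3
  simp only [fischerEigenvalue, Matrix.cons_val] at h0 h1 h2 h3
  refine ⟨?_, ?_, ?_, ?_⟩ <;> refine Int.cast_injective (α := ℂ) ?_ <;>
    push_cast [superDim]
  · linear_combination h0
  · linear_combination h1 / 2
  · linear_combination -h2
  · linear_combination -h3

theorem fischerEigenvalue_injective (hM : ∀ k : ℕ, superDim m n ≠ -(2 * k)) :
    Function.Injective (fischerEigenvalue m n) := by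
  intro t t' h
  obtain ⟨hweight, hR2lap, hcasimirB, hcasimirF⟩ := int_eqs_of_fischerEigenvalue_eq h
  have hm := pos_of_superDim_ne hM
  have hle := t.le
  have hle' := t'.le
  have hq : t.q = t'.q := by
    rcases mul_eq_zero.1 hcasimirF with h | h <;> omega
  have hp : t.p = t'.p := by
    rcases mul_eq_zero.1 hcasimirB with h | h <;> omega
  have hi : (t'.i : ℤ) = t.i + t.j - t'.j := by omega
  have hprod : ((t.j : ℤ) - t'.j)
      * (2 * (t.i + t'.i + t.p + t.q) + superDim m n - 2) = 0 := by
    rw [← hq, ← hp, hi] at hR2lap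
    rw [hi]
    linear_combination hR2lap
  have hj : t.j = t'.j := by
    rcases mul_eq_zero.1 hprod with h | h
    · omega
    · have := hM (t.i + t'.i + t.p + t.q - 1)
      omega
  exact FischerIndex.ext hj (by omega) hp hq

theorem fischerElt_mem_span_radial (j i p q : ℕ) (h : MvPolynomial (Fin m) ℂ) (w : Grassmann n) :
    fischerElt j i p q h w ∈ Submodule.span ℂ {u | ∃ a b, u = radial h w a b} := by
  induction j with
  | zero =>
    rw [fischerElt_zero, fPoly_mul_tmul]
    exact sum_mem fun s _ => Submodule.smul_mem _ _ (Submodule.subset_span ⟨_, _, rfl⟩)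
  | succ j ih =>
    rw [← R2_mul_fischerElt]
    refine (Submodule.span_le.2 ?_ : _ ≤ (Submodule.span ℂ _).comap
      (LinearMap.mulLeft ℂ (R2 m n))) ih
    rintro _ ⟨a, b, rfl⟩
    rw [SetLike.mem_coe, Submodule.mem_comap, LinearMap.mulLeft_apply, R2_mul_radial]
    exact add_mem (Submodule.subset_span ⟨_, _, rfl⟩) (Submodule.subset_span ⟨_, _, rfl⟩)

theorem apply_eq_smul_of_mem_span {K V : Type*} [CommRing K] [AddCommGroup V] [Module K V]
    {A : Module.End K V} {c : K} {s : Set V} (hs : ∀ u ∈ s, A u = c • u) {u : V}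
    (hu : u ∈ Submodule.span K s) : A u = c • u := by
  have h : Submodule.span K s ≤ LinearMap.ker (A - c • 1) :=
    Submodule.span_le.2 fun v hv => by simp [hs v hv]
  simpa [sub_eq_zero] using h hu

theorem casimirB_radial {p : ℕ} {h : MvPolynomial (Fin m) ℂ} (hh : h ∈ harmonicB m p)
    (w : Grassmann n) (a b : ℕ) :
    LinearMap.rTensor (Grassmann n)
      (SlTriple.casimir (LinearMap.mulLeft ℂ (normSqB m)) (lapB m) (weightB m)) (radial h w a b)
      = (-(((p : ℂ) + (m : ℂ) / 2) * ((p : ℂ) + (m : ℂ) / 2 - 2))) • radial h w a b := by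
  have h := slTriple_poly.casimir_raise_pow_of_ker a (weightB_of_isHomogeneous hh.1) hh.2
  rw [LinearMap.pow_mulLeft, LinearMap.mulLeft_apply] at h
  rw [radial, LinearMap.rTensor_tmul, h, TensorProduct.smul_tmul']

theorem casimirF_radial {q : ℕ} {w : Grassmann n} (hw : w ∈ harmonicF n q)
    (h : MvPolynomial (Fin m) ℂ) (a b : ℕ) :
    LinearMap.lTensor (MvPolynomial (Fin m) ℂ)
      (SlTriple.casimir (LinearMap.mulLeft ℂ (theta2 n)) (lapF n) (weightF n)) (radial h w a b)
      = (-(((q : ℂ) + -(n : ℂ)) * ((q : ℂ) + -(n : ℂ) - 2))) • radial h w a b := by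
  have h := slTriple_grassmann.casimir_raise_pow_of_ker b (weightF_of_mem hw.1) hw.2
  rw [LinearMap.pow_mulLeft, LinearMap.mulLeft_apply] at h
  rw [radial, LinearMap.lTensor_tmul, h, TensorProduct.tmul_smul]

theorem fischerOp_apply (hm : 0 < m) (t : FischerIndex n) {u : SuperPoly m n}
    (hu : u ∈ fischerPiece m n t) (l : Fin 4) :
    fischerOp m n l u = fischerEigenvalue m n t l • u := by
  refine apply_eq_smul_of_mem_span ?_ hu
  rintro _ ⟨h, hh, w, hw, rfl⟩
  have hradial := fischerElt_mem_span_radial t.j t.i t.p t.q h w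
  fin_cases l
  · exact weightP_fischerElt hh hw t.j t.i
  · exact R2_mul_lapP_fischerElt hm hh hw t.j t.le
  · refine apply_eq_smul_of_mem_span ?_ hradial
    rintro _ ⟨a, b, rfl⟩
    exact casimirB_radial hh w a b
  · refine apply_eq_smul_of_mem_span ?_ hradial
    rintro _ ⟨a, b, rfl⟩
    exact casimirF_radial hw h a b

theorem iSup_fischerPiece (hM : ∀ k : ℕ, superDim m n ≠ -(2 * k)) :
    ⨆ t, fischerPiece m n t = ⊤ := by
  rw [← top_le_iff, ← span_fischerElt hM, Submodule.span_le]
  rintro _ ⟨j, i, p, q, hi, h, hh, w, hw, rfl⟩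
  exact Submodule.mem_iSup_of_mem ⟨j, i, p, q, hi⟩ (Submodule.subset_span ⟨h, hh, w, hw, rfl⟩)

theorem exists_end_fischerPiece_eq_smul (hM : ∀ k : ℕ, superDim m n ≠ -(2 * k))
    (c : FischerIndex n → ℂ) :
    ∃ S : Module.End ℂ (SuperPoly m n), ∀ t, ∀ u ∈ fischerPiece m n t, S u = c t • u := by
  have hsup := iSup_fischerPiece hM
  have heigen (t : FischerIndex n) (u) (hu : u ∈ fischerPiece m n t) :=
    fischerOp_apply (pos_of_superDim_ne hM) t hu
  exact exists_end_eq_smul_of_iSupIndep (iSupIndep_of_joint_eigenspaces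
    (commute_of_iSup_eigenspaces hsup heigen) (fischerEigenvalue_injective hM) heigen) hsup c

end JointSpectrum

/-! ### The twist on superpolynomials -/

section PolyTwist

variable {m n : ℕ}

/-- The condition `T(R^{2j} f_{i,p,q} H^b H^f) = (-1)^i R^{2j} f_{i,p,q} H^b H̃^f` on a linear map
`T` of superpolynomials: the map of `IsTwist` with the Gaussian factor removed. -/
def IsPolyTwist (T : Module.End ℂ (SuperPoly m n)) : Prop :=
  ∀ j i p q, i + q ≤ n → ∀ h ∈ harmonicB m p, ∀ w ∈ harmonicF n q,
    T (fischerElt j i p q h w) = (-1 : ℂ) ^ i • fischerElt j i p q h (tilde n w)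

theorem map_twistHom_fischerElt (j i p q : ℕ) (h : MvPolynomial (Fin m) ℂ) (w : Grassmann n) :
    Algebra.TensorProduct.map (AlgHom.id ℂ (MvPolynomial (Fin m) ℂ)) (twistHom n)
      (fischerElt j i p q h w) = fischerElt j i p q h (twistHom n w) := by
  simp only [fischerElt, map_mul, map_pow, R2, map_add, r2, th2, fPoly, map_sum, map_smul,
    Algebra.TensorProduct.map_tmul, AlgHom.id_apply, map_one, twistHom_theta2]

theorem tilde_mem_harmonicF {q : ℕ} {w : Grassmann n} (hw : w ∈ harmonicF n q) :
    tilde n w ∈ harmonicF n q := by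
  rw [tilde_of_mem hw.1]
  exact Submodule.smul_mem _ _ (twistHom_mem_harmonicF hw)

theorem exists_isPolyTwist (hM : ∀ k : ℕ, superDim m n ≠ -(2 * k)) :
    ∃ T : Module.End ℂ (SuperPoly m n), IsPolyTwist T := by
  obtain ⟨S, hS⟩ := exists_end_fischerPiece_eq_smul hM fun t => (-1 : ℂ) ^ t.i * (-1) ^ t.q.choose 2
  refine ⟨S ∘ₗ (Algebra.TensorProduct.map (AlgHom.id ℂ (MvPolynomial (Fin m) ℂ))
    (twistHom n)).toLinearMap, fun j i p q hi h hh w hw => ?_⟩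
  rw [LinearMap.comp_apply, AlgHom.toLinearMap_apply, map_twistHom_fischerElt,
    hS ⟨j, i, p, q, hi⟩ _
      (Submodule.subset_span ⟨h, hh, twistHom n w, twistHom_mem_harmonicF hw, rfl⟩),
    tilde_of_mem hw.1, fischerElt_smul_right, smul_smul]

theorem linearMap_ext_fischerElt (hM : ∀ k : ℕ, superDim m n ≠ -(2 * k)) {V : Type*}
    [AddCommGroup V] [Module ℂ V] {A B : SuperPoly m n →ₗ[ℂ] V}
    (hAB : ∀ j i p q, i + q ≤ n → ∀ h ∈ harmonicB m p, ∀ w ∈ harmonicF n q,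
      A (fischerElt j i p q h w) = B (fischerElt j i p q h w)) : A = B := by
  refine LinearMap.ext_on (span_fischerElt hM) ?_
  rintro _ ⟨j, i, p, q, hi, h, hh, w, hw, rfl⟩
  exact hAB j i p q hi h hh w hw

namespace IsPolyTwist

variable {T : Module.End ℂ (SuperPoly m n)}

theorem commute_R2 (hT : IsPolyTwist T) (hM : ∀ k : ℕ, superDim m n ≠ -(2 * k)) :
    Commute T (LinearMap.mulLeft ℂ (R2 m n)) := by
  refine linearMap_ext_fischerElt hM fun j i p q hi h hh w hw => ?_
  rw [Module.End.mul_apply, Module.End.mul_apply, LinearMap.mulLeft_apply, R2_mul_fischerElt,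
    hT _ _ _ _ hi _ hh _ hw, hT _ _ _ _ hi _ hh _ hw, map_smul, LinearMap.mulLeft_apply,
    R2_mul_fischerElt]

theorem commute_lapP (hT : IsPolyTwist T) (hM : ∀ k : ℕ, superDim m n ≠ -(2 * k)) :
    Commute T (lapP m n) := by
  have hm := pos_of_superDim_ne hM
  refine linearMap_ext_fischerElt hM fun j i p q hi h hh w hw => ?_
  have hw' := tilde_mem_harmonicF hw
  rw [Module.End.mul_apply, Module.End.mul_apply, hT _ _ _ _ hi _ hh _ hw, map_smul]
  cases j with
  | zero =>
    rw [lapP_fischerElt_zero hm hh hw hi, lapP_fischerElt_zero hm hh hw' hi, map_zero, smul_zero]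
  | succ j =>
    rw [lapP_fischerElt_succ hm hh hw j hi, lapP_fischerElt_succ hm hh hw' j hi, map_smul,
      hT _ _ _ _ hi _ hh _ hw, smul_comm]

theorem commute_weightP (hT : IsPolyTwist T) (hM : ∀ k : ℕ, superDim m n ≠ -(2 * k)) :
    Commute T (weightP m n) :=
  haveI := IsAddTorsionFree.of_module_rat (Module.End ℂ (SuperPoly m n))
  slTriple_superPoly.commute_weight (hT.commute_R2 hM) (hT.commute_lapP hM)

end IsPolyTwist

end PolyTwist

/-! ### The space `𝒫 exp(-R²/2)` -/

section PolyGauss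

variable {m n : ℕ}

theorem mulGauss_tmul (p : MvPolynomial (Fin m) ℂ) (a : Grassmann n) :
    mulGauss m n (p ⊗ₜ a) = (MvPolynomial.aeval coord p * gaussB m) ⊗ₜ (a * gaussF n) :=
  Algebra.TensorProduct.tmul_mul_tmul _ _ _ _

theorem isUnit_gaussB_tmul_gaussF : IsUnit (gaussB m ⊗ₜ gaussF n : SuperFun m n) := by
  have h := (isUnit_gaussB (m := m).map
    (Algebra.TensorProduct.includeLeft : smooth m →ₐ[ℂ] SuperFun m n)).mul
      (isUnit_gaussF (n := n).map
        (Algebra.TensorProduct.includeRight : Grassmann n →ₐ[ℂ] SuperFun m n))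
  rwa [Algebra.TensorProduct.includeLeft_apply, Algebra.TensorProduct.includeRight_apply,
    Algebra.TensorProduct.tmul_mul_tmul, mul_one, one_mul] at h

theorem mulGauss_injective : Function.Injective (mulGauss m n) :=
  isUnit_gaussB_tmul_gaussF.mul_left_injective.comp
    (Module.Flat.rTensor_preserves_injective_linearMap (M := Grassmann n)
      (MvPolynomial.aeval (R := ℂ) (coord (m := m))).toLinearMap aeval_coord_injective)

theorem mulR2_eq : mulR2 m n
    = LinearMap.rTensor (Grassmann n) (LinearMap.mulLeft ℂ (∑ i : Fin m, coord i ^ 2))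
      + LinearMap.lTensor (smooth m) (LinearMap.mulLeft ℂ (theta2 n)) := by
  have hR2 : polyFun m n (R2 m n) = (∑ i, coord i ^ 2) ⊗ₜ 1 + 1 ⊗ₜ theta2 n := by
    simp only [R2, r2, th2, polyFun, map_add, Algebra.TensorProduct.map_tmul, map_one, map_sum,
      map_pow, MvPolynomial.aeval_X, AlgHom.id_apply]
  refine TensorProduct.ext' fun f a => ?_
  simp only [mulR2, hR2, LinearMap.mulLeft_apply, add_mul, Algebra.TensorProduct.tmul_mul_tmul,
    one_mul, LinearMap.add_apply, LinearMap.rTensor_tmul, LinearMap.lTensor_tmul]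

theorem mulR2_tmul (f : smooth m) (a : Grassmann n) :
    mulR2 m n (f ⊗ₜ a) = ((∑ i, coord i ^ 2) * f) ⊗ₜ a + f ⊗ₜ (theta2 n * a) := by
  rw [mulR2_eq]
  rfl

theorem lap_tmul (f : smooth m) (a : Grassmann n) :
    lap m n (f ⊗ₜ a) = ((∑ i : Fin m, bDeriv i * bDeriv i) f) ⊗ₜ a + f ⊗ₜ lapF n a := rfl

theorem mulR2_mul (f g : SuperFun m n) : mulR2 m n f * g = f * mulR2 m n g := by
  have hcentral (f : SuperFun m n) : Commute (polyFun m n (R2 m n)) f := by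
    induction f using TensorProduct.induction_on with
    | zero => exact Commute.zero_right _
    | add f g hf hg => exact hf.add_right hg
    | tmul f a =>
      change mulR2 m n (f ⊗ₜ a) = _
      simp only [mulR2_tmul, R2, r2, th2, polyFun, map_add, Algebra.TensorProduct.map_tmul,
        map_one, map_sum, map_pow, MvPolynomial.aeval_X, AlgHom.id_apply, mul_add,
        Algebra.TensorProduct.tmul_mul_tmul, one_mul, mul_one, (commute_theta2 a).eq, mul_comm f]
  rw [mulR2, LinearMap.mulLeft_apply, LinearMap.mulLeft_apply, (hcentral f).eq, mul_assoc]

theorem mulR2_mulGauss (P : SuperPoly m n) :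
    mulR2 m n (mulGauss m n P) = mulGauss m n (LinearMap.mulLeft ℂ (R2 m n) P) := by
  simp only [mulR2, mulGauss, LinearMap.comp_apply, LinearMap.mulLeft_apply,
    LinearMap.mulRight_apply, AlgHom.toLinearMap_apply, map_mul, mul_assoc]

theorem lap_mulGauss (P : SuperPoly m n) :
    lap m n (mulGauss m n P)
      = mulGauss m n
        ((lapP m n - (2 : ℂ) • weightP m n + LinearMap.mulLeft ℂ (R2 m n)) P) := by
  induction P using TensorProduct.induction_on with
  | zero => simp only [map_zero]
  | add P Q hP hQ => simp only [map_add, hP, hQ]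
  | tmul p a =>
    rw [mulGauss_tmul, lap_tmul, sum_bDeriv_sq_aeval_mul_gaussB, lapF_mul_gaussF, ← mulGauss_tmul,
      ← mulGauss_tmul, ← map_add, mulLeft_R2]
    congr 1
    simp only [lapP, weightP, LinearMap.add_apply, LinearMap.sub_apply, LinearMap.smul_apply,
      LinearMap.rTensor_tmul, LinearMap.lTensor_tmul, LinearMap.mulLeft_apply,
      TensorProduct.add_tmul, TensorProduct.sub_tmul, TensorProduct.tmul_add,
      TensorProduct.tmul_sub, ← TensorProduct.smul_tmul', TensorProduct.tmul_smul]
    module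

theorem mulR2_mem {f : SuperFun m n} (hf : f ∈ polyGauss m n) : mulR2 m n f ∈ polyGauss m n := by
  obtain ⟨P, rfl⟩ := hf
  exact ⟨_, (mulR2_mulGauss P).symm⟩

theorem lap_mem {f : SuperFun m n} (hf : f ∈ polyGauss m n) : lap m n f ∈ polyGauss m n := by
  obtain ⟨P, rfl⟩ := hf
  exact ⟨_, (lap_mulGauss P).symm⟩

theorem eulerShift_eq_commutator :
    eulerShift m n = (1 / 2 : ℂ) • (lap m n * mulR2 m n - mulR2 m n * lap m n) := by
  have hcomm := (slTriple_smooth.tensor slTriple_grassmann :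
    SlTriple (_ + _ : Module.End ℂ (SuperFun m n)) _ _).lower_mul_raise
  rw [← mulR2_eq] at hcomm
  rw [lap, hcomm, add_sub_cancel_left]
  refine TensorProduct.ext' fun f a => ?_
  simp only [eulerShift, euler, superDim, weightF, LinearMap.add_apply, LinearMap.sub_apply,
    LinearMap.smul_apply, Module.End.one_apply, LinearMap.rTensor_tmul, LinearMap.lTensor_tmul,
    TensorProduct.add_tmul, TensorProduct.tmul_sub, ← TensorProduct.smul_tmul',
    TensorProduct.tmul_smul]
  push_cast
  module

/-- Polynomials times the bosonic Gaussian `exp(-r²/2)`: the bosonic tensor factor of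
`polyGauss`. -/
def polyGaussB (m : ℕ) : Submodule ℂ (smooth m) :=
  LinearMap.range (LinearMap.mulRight ℂ (gaussB m)
    ∘ₗ (MvPolynomial.aeval (R := ℂ) (coord (m := m))).toLinearMap)

theorem aeval_mul_gaussB_mem (p : MvPolynomial (Fin m) ℂ) :
    MvPolynomial.aeval coord p * gaussB m ∈ polyGaussB m :=
  ⟨p, rfl⟩

theorem bDeriv_mem {u : smooth m} (hu : u ∈ polyGaussB m) (i : Fin m) :
    bDeriv i u ∈ polyGaussB m := by
  obtain ⟨p, rfl⟩ := hu
  exact ⟨_, (bDeriv_aeval_mul_gaussB i p).symm⟩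

theorem sum_bDeriv_sq_mem {u : smooth m} (hu : u ∈ polyGaussB m) :
    (∑ i : Fin m, bDeriv i * bDeriv i) u ∈ polyGaussB m := by
  rw [LinearMap.sum_apply]
  exact sum_mem fun i _ => bDeriv_mem (bDeriv_mem hu i) i

theorem bConj_mem {u : smooth m} (hu : u ∈ polyGaussB m) : bConj m u ∈ polyGaussB m := by
  obtain ⟨p, rfl⟩ := hu
  refine ⟨MvPolynomial.map (starRingEnd ℂ) p, ?_⟩
  simp only [LinearMap.comp_apply, AlgHom.toLinearMap_apply, LinearMap.mulRight_apply, bConj_mul,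
    bConj_aeval, bConj_gaussB]

theorem tmul_mem_polyGauss {u : smooth m} (hu : u ∈ polyGaussB m) (a : Grassmann n) :
    u ⊗ₜ a ∈ polyGauss m n := by
  obtain ⟨p, rfl⟩ := hu
  obtain ⟨b, rfl⟩ := (IsUnit.isUnit_iff_mulRight_bijective.1 (isUnit_gaussF (n := n))).surjective a
  exact ⟨p ⊗ₜ b, mulGauss_tmul p b⟩

@[elab_as_elim]
theorem polyGauss_induction {motive : ∀ f : SuperFun m n, f ∈ polyGauss m n → Prop}
    (tmul : ∀ u (hu : u ∈ polyGaussB m) a, motive (u ⊗ₜ a) (tmul_mem_polyGauss hu a))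
    (add : ∀ f g hf hg, motive f hf → motive g hg → motive (f + g) (add_mem hf hg))
    {f : SuperFun m n} (hf : f ∈ polyGauss m n) : motive f hf := by
  obtain ⟨P, rfl⟩ := hf
  induction P using TensorProduct.induction_on with
  | zero => simpa only [TensorProduct.zero_tmul, map_zero] using tmul 0 (zero_mem _) 0
  | tmul p a => simpa only [mulGauss_tmul] using tmul _ (aeval_mul_gaussB_mem p) (a * gaussF n)
  | add P Q hP hQ => simpa only [map_add] using add _ _ ⟨P, rfl⟩ ⟨Q, rfl⟩ hP hQ

/-! ### Complex conjugation of superfunctions -/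

theorem superConj_tmul (f : smooth m) (a : Grassmann n) :
    superConj m n (f ⊗ₜ a) = bConj m f ⊗ₜ gConj n a := rfl

theorem superConj_mem {f : SuperFun m n} (hf : f ∈ polyGauss m n) :
    superConj m n f ∈ polyGauss m n := by
  induction hf using polyGauss_induction with
  | tmul u hu a => exact tmul_mem_polyGauss (bConj_mem hu) _
  | add f g _ _ hf hg => exact map_add (superConj m n) f g ▸ add_mem hf hg

theorem superConj_lap (f : SuperFun m n) :
    superConj m n (lap m n f) = lap m n (superConj m n f) := by
  induction f using TensorProduct.induction_on with
  | zero => simp only [map_zero]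
  | add f g hf hg => simp only [map_add, hf, hg]
  | tmul f a =>
    simp only [superConj_tmul, lap_tmul, map_add, gConj_lapF, LinearMap.sum_apply, map_sum,
      Module.End.mul_apply, bConj_bDeriv]

theorem superConj_mulR2 (f : SuperFun m n) :
    superConj m n (mulR2 m n f) = mulR2 m n (superConj m n f) := by
  induction f using TensorProduct.induction_on with
  | zero => simp only [map_zero]
  | add f g hf hg => simp only [map_add, hf, hg]
  | tmul f a =>
    simp only [superConj_tmul, mulR2_tmul, map_add, gConj_mul, gConj_theta2, bConj_mul, map_sum,
      pow_two, bConj_coord]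

end PolyGauss

/-! ### Integrals of polynomials times Gaussians -/

section Integral

open MeasureTheory

theorem abs_le_mul_exp_mul_sq {ε : ℝ} (hε : 0 < ε) (t : ℝ) :
    |t| ≤ (1 + 1 / ε) * Real.exp (ε * t ^ 2) :=
  calc |t| ≤ 1 + t ^ 2 := by nlinarith [sq_nonneg (|t| - 1), sq_abs t, abs_nonneg t]
    _ ≤ 1 + t ^ 2 + (ε * t ^ 2 + 1 / ε) := le_add_of_nonneg_right (by positivity)
    _ = (1 + 1 / ε) * (ε * t ^ 2 + 1) := by field_simp; ring
    _ ≤ (1 + 1 / ε) * Real.exp (ε * t ^ 2) := by gcongr; exact Real.add_one_le_exp _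

theorem integrable_exp_neg_mul_sq_norm {V : Type*} [NormedAddCommGroup V] [InnerProductSpace ℝ V]
    [FiniteDimensional ℝ V] [MeasurableSpace V] [BorelSpace V] {b : ℝ} (hb : 0 < b) :
    Integrable fun x : V => Real.exp (-b * ‖x‖ ^ 2) := by
  have h := GaussianFourier.integrable_cexp_neg_mul_sq_norm_add (V := V) (b := b)
    (by simpa using hb) 0 0
  refine h.norm.congr (Filter.Eventually.of_forall fun x => ?_)
  simp only [Complex.norm_exp, zero_mul, add_zero]
  norm_cast

variable {m : ℕ}

theorem exists_norm_eval_le_mul_exp (p : MvPolynomial (Fin m) ℂ) {ε : ℝ} (hε : 0 < ε) :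
    ∃ C, ∀ x : EuclideanSpace ℝ (Fin m),
      ‖MvPolynomial.eval (fun i => ((x i : ℝ) : ℂ)) p‖ ≤ C * Real.exp (ε * ‖x‖ ^ 2) := by
  induction p using MvPolynomial.induction_on generalizing ε with
  | C a =>
    refine ⟨‖a‖, fun x => ?_⟩
    rw [MvPolynomial.eval_C]
    exact le_mul_of_one_le_right (norm_nonneg _) (Real.one_le_exp (by positivity))
  | add p q hp hq =>
    obtain ⟨C, hC⟩ := hp hε
    obtain ⟨D, hD⟩ := hq hε
    refine ⟨C + D, fun x => ?_⟩
    rw [map_add, add_mul]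
    exact (norm_add_le _ _).trans (add_le_add (hC x) (hD x))
  | mul_X p j hp =>
    obtain ⟨C, hC⟩ := hp (half_pos hε)
    refine ⟨C * (1 + 1 / (ε / 2)), fun x => ?_⟩
    have hcoord : ‖((x j : ℝ) : ℂ)‖ ≤ (1 + 1 / (ε / 2)) * Real.exp (ε / 2 * ‖x‖ ^ 2) := by
      rw [Complex.norm_real]
      exact (PiLp.norm_apply_le x j).trans
        ((le_abs_self _).trans (abs_le_mul_exp_mul_sq (half_pos hε) ‖x‖))
    rw [map_mul, MvPolynomial.eval_X, norm_mul]
    calc _ ≤ (C * Real.exp (ε / 2 * ‖x‖ ^ 2))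
          * ((1 + 1 / (ε / 2)) * Real.exp (ε / 2 * ‖x‖ ^ 2)) :=
          mul_le_mul (hC x) hcoord (norm_nonneg _) ((norm_nonneg _).trans (hC x))
      _ = C * (1 + 1 / (ε / 2)) * Real.exp (ε / 2 * ‖x‖ ^ 2 + ε / 2 * ‖x‖ ^ 2) := by
          rw [Real.exp_add]; ring
      _ = _ := by ring_nf

theorem gaussB_apply (x : EuclideanSpace ℝ (Fin m)) :
    (gaussB m).1 x = (Real.exp (-(1 / 2) * ‖x‖ ^ 2) : ℝ) := by
  change ((Real.exp (-(∑ i, x i ^ 2) / 2) : ℝ) : ℂ) = _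
  rw [EuclideanSpace.real_norm_sq_eq]
  ring_nf

theorem integrable_mul {u v : smooth m} (hu : u ∈ polyGaussB m) (hv : v ∈ polyGaussB m) :
    Integrable (u * v).1 := by
  have hsmooth : ContDiff ℝ ∞ (u * v).1 := (u * v).2
  obtain ⟨p, rfl⟩ := hu
  obtain ⟨q, rfl⟩ := hv
  obtain ⟨C, hC⟩ := exists_norm_eval_le_mul_exp (p * q) one_half_pos
  refine ((integrable_exp_neg_mul_sq_norm one_half_pos).const_mul C).mono'
    hsmooth.continuous.aestronglyMeasurable (Filter.Eventually.of_forall fun x => ?_)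
  calc ‖((MvPolynomial.aeval coord p : smooth m).1 x * (gaussB m).1 x)
        * ((MvPolynomial.aeval coord q : smooth m).1 x * (gaussB m).1 x)‖
      = ‖MvPolynomial.eval (fun i => ((x i : ℝ) : ℂ)) (p * q)‖ * Real.exp (-‖x‖ ^ 2) := by
        rw [mul_mul_mul_comm, norm_mul, aeval_coord_apply, aeval_coord_apply, ← map_mul,
          gaussB_apply, ← Complex.ofReal_mul, ← Real.exp_add, Complex.norm_real, Real.norm_eq_abs,
          Real.abs_exp]
        ring_nf
    _ ≤ C * Real.exp (1 / 2 * ‖x‖ ^ 2) * Real.exp (-‖x‖ ^ 2) := by gcongr; exact hC x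
    _ = C * Real.exp (-(1 / 2) * ‖x‖ ^ 2) := by rw [mul_assoc, ← Real.exp_add]; ring_nf

theorem integral_bDeriv_mul (i : Fin m) {u v : smooth m} (hu : u ∈ polyGaussB m)
    (hv : v ∈ polyGaussB m) :
    ∫ x, (bDeriv i u * v).1 x = -∫ x, (u * bDeriv i v).1 x :=
  neg_eq_iff_eq_neg.1 (integral_mul_fderiv_eq_neg_fderiv_mul_of_integrable (μ := volume)
    (v := EuclideanSpace.single i (1 : ℝ)) (integrable_mul (bDeriv_mem hu i) hv)
    (integrable_mul hu (bDeriv_mem hv i)) (integrable_mul hu hv)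
    (fun x _ => smooth_differentiable u x) fun x _ => smooth_differentiable v x).symm

theorem integral_sum_bDeriv_sq_mul {u v : smooth m} (hu : u ∈ polyGaussB m)
    (hv : v ∈ polyGaussB m) :
    ∫ x, ((∑ i : Fin m, bDeriv i * bDeriv i) u * v).1 x
      = ∫ x, (u * (∑ i : Fin m, bDeriv i * bDeriv i) v).1 x := by
  have hcoe (F : Fin m → smooth m) (x : EuclideanSpace ℝ (Fin m)) :
      (∑ i, F i).1 x = ∑ i, (F i).1 x := by
    rw [← Finset.sum_apply]
    exact congrFun (AddSubmonoidClass.coe_finsetSum F Finset.univ) x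
  simp only [LinearMap.sum_apply, Module.End.mul_apply, Finset.sum_mul, Finset.mul_sum, hcoe]
  rw [integral_finsetSum _ fun i _ => integrable_mul (bDeriv_mem (bDeriv_mem hu i) i) hv,
    integral_finsetSum _ fun i _ => integrable_mul hu (bDeriv_mem (bDeriv_mem hv i) i)]
  refine Finset.sum_congr rfl fun i _ => ?_
  rw [integral_bDeriv_mul i (bDeriv_mem hu i) hv, integral_bDeriv_mul i hu (bDeriv_mem hv i),
    neg_neg]

/-! ### The superintegral -/

variable {n : ℕ}

/-- The Berezin integral of a superfunction: the integrand of `superInt`. -/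
def superBerezin (m n : ℕ) : SuperFun m n →ₗ[ℂ] smooth m :=
  (TensorProduct.rid ℂ (smooth m)).toLinearMap ∘ₗ LinearMap.lTensor (smooth m) (berezin n)

theorem superInt_eq (f : SuperFun m n) : superInt f = ∫ x, (superBerezin m n f).1 x := rfl

theorem superBerezin_tmul (f : smooth m) (a : Grassmann n) :
    superBerezin m n (f ⊗ₜ a) = berezin n a • f := by
  rw [superBerezin, LinearMap.comp_apply, LinearMap.lTensor_tmul]
  exact TensorProduct.rid_tmul _ _

theorem integrable_superBerezin_mul {f g : SuperFun m n} (hf : f ∈ polyGauss m n)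
    (hg : g ∈ polyGauss m n) : Integrable (superBerezin m n (f * g)).1 := by
  induction hf using polyGauss_induction with
  | add f f' _ _ hf hf' => rw [add_mul, map_add]; exact hf.add hf'
  | tmul u hu a =>
    induction hg using polyGauss_induction with
    | add g g' _ _ hg hg' => rw [mul_add, map_add]; exact hg.add hg'
    | tmul v hv b =>
      rw [Algebra.TensorProduct.tmul_mul_tmul, superBerezin_tmul]
      exact (integrable_mul hu hv).smul (berezin n (a * b))

theorem superInt_tmul (f : smooth m) (a : Grassmann n) :
    superInt (f ⊗ₜ a) = berezin n a * ∫ x, f.1 x := by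
  rw [superInt_eq, superBerezin_tmul]
  exact integral_smul (berezin n a) _

theorem superInt_smul (c : ℂ) (f : SuperFun m n) : superInt (c • f) = c * superInt f := by
  rw [superInt_eq, map_smul]
  exact integral_smul c _

theorem superInt_add_mul {f f' g : SuperFun m n} (hf : f ∈ polyGauss m n)
    (hf' : f' ∈ polyGauss m n) (hg : g ∈ polyGauss m n) :
    superInt ((f + f') * g) = superInt (f * g) + superInt (f' * g) := by
  rw [add_mul, superInt_eq, map_add]
  exact integral_add (integrable_superBerezin_mul hf hg) (integrable_superBerezin_mul hf' hg)

theorem superInt_mul_add {f g g' : SuperFun m n} (hf : f ∈ polyGauss m n) (hg : g ∈ polyGauss m n)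
    (hg' : g' ∈ polyGauss m n) :
    superInt (f * (g + g')) = superInt (f * g) + superInt (f * g') := by
  rw [mul_add, superInt_eq, map_add]
  exact integral_add (integrable_superBerezin_mul hf hg) (integrable_superBerezin_mul hf hg')

theorem superInt_lap_mul {f g : SuperFun m n} (hf : f ∈ polyGauss m n) (hg : g ∈ polyGauss m n) :
    superInt (lap m n f * g) = superInt (f * lap m n g) := by
  induction hf using polyGauss_induction with
  | add f f' hf hf' ih ih' =>
    rw [map_add, superInt_add_mul (lap_mem hf) (lap_mem hf') hg, ih, ih',
      superInt_add_mul hf hf' (lap_mem hg)]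
  | tmul u hu a =>
    have hf := tmul_mem_polyGauss hu a
    induction hg using polyGauss_induction with
    | add g g' hg hg' ih ih' =>
      rw [map_add, superInt_mul_add (lap_mem hf) hg hg', ih, ih',
        superInt_mul_add hf (lap_mem hg) (lap_mem hg')]
    | tmul v hv b =>
      have hg := tmul_mem_polyGauss hv b
      rw [lap_tmul, lap_tmul,
        superInt_add_mul (tmul_mem_polyGauss (sum_bDeriv_sq_mem hu) a)
          (tmul_mem_polyGauss hu (lapF n a)) hg,
        superInt_mul_add hf (tmul_mem_polyGauss (sum_bDeriv_sq_mem hv) b)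
          (tmul_mem_polyGauss hv (lapF n b))]
      simp only [Algebra.TensorProduct.tmul_mul_tmul, superInt_tmul, berezin_lapF_mul,
        integral_sum_bDeriv_sq_mul hu hv]

end Integral

/-! ### The map `T` -/

section Twist

variable {m n : ℕ}

/-- Multiplication by the Gaussian as an isomorphism from `𝒫` onto `𝒫 exp(-R²/2)`. -/
def polyGaussEquiv (m n : ℕ) : SuperPoly m n ≃ₗ[ℂ] polyGauss m n :=
  LinearEquiv.ofInjective (mulGauss m n) mulGauss_injective

theorem isTwist_conj_iff {S : Module.End ℂ (SuperPoly m n)} :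
    IsTwist m n ((polyGaussEquiv m n).conj S) ↔ IsPolyTwist S := by
  simp only [IsTwist, IsPolyTwist]
  refine forall₅_congr fun j i p q _ => forall₄_congr fun h _ w _ => ?_
  change (polyGaussEquiv m n).conj S (polyGaussEquiv m n _) = polyGaussEquiv m n _ ↔ _
  rw [LinearEquiv.conj_apply_apply, LinearEquiv.symm_apply_apply,
    (polyGaussEquiv m n).injective.eq_iff]
  rfl

theorem existsUnique_isTwist (hM : ∀ k : ℕ, superDim m n ≠ -(2 * k)) :
    ∃! T : polyGauss m n →ₗ[ℂ] polyGauss m n, IsTwist m n T := by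
  obtain ⟨S, hS⟩ := exists_isPolyTwist hM
  refine ⟨_, isTwist_conj_iff.2 hS, fun T hT => ?_⟩
  obtain ⟨S', rfl⟩ := (polyGaussEquiv m n).conj.surjective T
  have hS' := isTwist_conj_iff.1 hT
  congr 1
  exact linearMap_ext_fischerElt hM fun j i p q hi h hh w hw =>
    (hS' j i p q hi h hh w hw).trans (hS j i p q hi h hh w hw).symm

theorem isTwist_twist (hM : ∀ k : ℕ, superDim m n ≠ -(2 * k)) : IsTwist m n (twist m n) :=
  Classical.epsilon_spec (existsUnique_isTwist hM).exists

theorem twist_apply_of_forall_commute (hM : ∀ k : ℕ, superDim m n ≠ -(2 * k))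
    {A : Module.End ℂ (SuperFun m n)} (hA : ∀ f ∈ polyGauss m n, A f ∈ polyGauss m n)
    {B : Module.End ℂ (SuperPoly m n)} (hAB : ∀ P, A (mulGauss m n P) = mulGauss m n (B P))
    (hB : ∀ S : Module.End ℂ (SuperPoly m n), IsPolyTwist S → Commute S B) (g : polyGauss m n) :
    (twist m n (A.restrict hA g) : SuperFun m n) = A (twist m n g) := by
  obtain ⟨S, hS⟩ := (polyGaussEquiv m n).conj.surjective (twist m n)
  have hcomm := hB S (isTwist_conj_iff.1 (hS ▸ isTwist_twist hM))
  have htwist (P : SuperPoly m n) :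
      twist m n (polyGaussEquiv m n P) = polyGaussEquiv m n (S P) := by
    rw [← hS, LinearEquiv.conj_apply_apply, LinearEquiv.symm_apply_apply]
  obtain ⟨P, rfl⟩ := (polyGaussEquiv m n).surjective g
  have hrestrict : A.restrict hA (polyGaussEquiv m n P) = polyGaussEquiv m n (B P) :=
    Subtype.ext (hAB P)
  rw [hrestrict, htwist, htwist]
  exact (congrArg (mulGauss m n) (LinearMap.congr_fun hcomm.eq P)).trans (hAB (S P)).symm

theorem twist_mulR2 (hM : ∀ k : ℕ, superDim m n ≠ -(2 * k)) (g : polyGauss m n) :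
    (twist m n ((mulR2 m n).restrict (fun _ => mulR2_mem) g) : SuperFun m n)
      = mulR2 m n (twist m n g) :=
  twist_apply_of_forall_commute hM _ mulR2_mulGauss (fun _ hS => hS.commute_R2 hM) g

theorem twist_lap (hM : ∀ k : ℕ, superDim m n ≠ -(2 * k)) (g : polyGauss m n) :
    (twist m n ((lap m n).restrict (fun _ => lap_mem) g) : SuperFun m n)
      = lap m n (twist m n g) :=
  twist_apply_of_forall_commute hM _ lap_mulGauss (fun _ hS => ((hS.commute_lapP hM).sub_right
    ((hS.commute_weightP hM).smul_right _)).add_right (hS.commute_R2 hM)) g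

end Twist

/-! ### Adjoints -/

section Adjoint

variable {m n : ℕ}

theorem superConj_twist_mem (g : polyGauss m n) :
    superConj m n (twist m n g : SuperFun m n) ∈ polyGauss m n :=
  superConj_mem (twist m n g).2

theorem inner2_add_left (f f' g : polyGauss m n) :
    inner2 (f + f') g = inner2 f g + inner2 f' g :=
  superInt_add_mul f.2 f'.2 (superConj_twist_mem g)

theorem inner2_add_right (f g g' : polyGauss m n) :
    inner2 f (g + g') = inner2 f g + inner2 f g' := by
  rw [inner2, map_add, Submodule.coe_add, map_add]
  exact superInt_mul_add f.2 (superConj_twist_mem g) (superConj_twist_mem g')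

theorem inner2_smul_left (c : ℂ) (f g : polyGauss m n) : inner2 (c • f) g = c * inner2 f g := by
  rw [inner2, Submodule.coe_smul, smul_mul_assoc, superInt_smul]
  rfl

theorem inner2_smul_right (c : ℂ) (f g : polyGauss m n) :
    inner2 f (c • g) = starRingEnd ℂ c * inner2 f g := by
  rw [inner2, map_smul, Submodule.coe_smul, map_smulₛₗ, mul_smul_comm, superInt_smul]
  rfl

namespace IsAdjoint

variable {A A' B B' : Module.End ℂ (SuperFun m n)}

theorem add (h : IsAdjoint A B) (h' : IsAdjoint A' B') : IsAdjoint (A + A') (B + B') := by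
  obtain ⟨hA, hB, hAB⟩ := h
  obtain ⟨hA', hB', hAB'⟩ := h'
  refine ⟨fun f hf => add_mem (hA f hf) (hA' f hf), fun f hf => add_mem (hB f hf) (hB' f hf),
    fun f g => ?_⟩
  calc inner2 (A.restrict hA f + A'.restrict hA' f) g
      = inner2 f (B.restrict hB g + B'.restrict hB' g) := by
        rw [inner2_add_left, inner2_add_right, hAB, hAB']

theorem smul (h : IsAdjoint A B) (c : ℂ) : IsAdjoint (c • A) (starRingEnd ℂ c • B) := by
  obtain ⟨hA, hB, hAB⟩ := h
  refine ⟨fun f hf => Submodule.smul_mem _ _ (hA f hf),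
    fun f hf => Submodule.smul_mem _ _ (hB f hf), fun f g => ?_⟩
  calc inner2 (c • A.restrict hA f) g = inner2 f (starRingEnd ℂ c • B.restrict hB g) := by
        rw [inner2_smul_left, inner2_smul_right, Complex.conj_conj, hAB]

theorem mul (h : IsAdjoint A B) (h' : IsAdjoint A' B') : IsAdjoint (A * A') (B' * B) := by
  obtain ⟨hA, hB, hAB⟩ := h
  obtain ⟨hA', hB', hAB'⟩ := h'
  exact ⟨fun f hf => hA _ (hA' f hf), fun f hf => hB' _ (hB f hf),
    fun f g => (hAB (A'.restrict hA' f) g).trans (hAB' f (B.restrict hB g))⟩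

theorem one : IsAdjoint (1 : Module.End ℂ (SuperFun m n)) 1 :=
  ⟨fun _ hf => hf, fun _ hf => hf, fun _ _ => rfl⟩

theorem pow (h : IsAdjoint A B) (k : ℕ) : IsAdjoint (A ^ k) (B ^ k) := by
  induction k with
  | zero => exact one
  | succ k ih => exact pow_succ A k ▸ pow_succ' B k ▸ ih.mul h

theorem aeval_map (h : IsAdjoint A B) (V : Polynomial ℝ) :
    IsAdjoint (Polynomial.aeval A (V.map (algebraMap ℝ ℂ)))
      (Polynomial.aeval B (V.map (algebraMap ℝ ℂ))) := by
  induction V using Polynomial.induction_on' with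
  | add V W hV hW =>
    simp only [Polynomial.map_add, map_add]
    exact hV.add hW
  | monomial k c =>
    simp only [Polynomial.map_monomial, Polynomial.aeval_monomial, ← Algebra.smul_def]
    have hk := (h.pow k).smul (c : ℂ)
    rwa [Complex.conj_ofReal] at hk

end IsAdjoint

theorem isAdjoint_mulR2 (hM : ∀ k : ℕ, superDim m n ≠ -(2 * k)) :
    IsAdjoint (mulR2 m n) (mulR2 m n) := by
  refine ⟨fun _ => mulR2_mem, fun _ => mulR2_mem, fun f g => ?_⟩
  rw [inner2, inner2, twist_mulR2 hM, superConj_mulR2, ← mulR2_mul]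
  rfl

theorem isAdjoint_lap (hM : ∀ k : ℕ, superDim m n ≠ -(2 * k)) :
    IsAdjoint (lap m n) (lap m n) := by
  refine ⟨fun _ => lap_mem, fun _ => lap_mem, fun f g => ?_⟩
  rw [inner2, inner2, twist_lap hM, superConj_lap]
  exact superInt_lap_mul f.2 (superConj_twist_mem g)

theorem isAdjoint_eulerShift (hM : ∀ k : ℕ, superDim m n ≠ -(2 * k)) :
    IsAdjoint (eulerShift m n) (-eulerShift m n) := by
  have hX := isAdjoint_mulR2 hM
  have hY := isAdjoint_lap hM
  convert ((hY.mul hX).add ((hX.mul hY).smul (-1))).smul (1 / 2) using 1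
  · rw [eulerShift_eq_commutator]
    module
  · rw [eulerShift_eq_commutator, map_neg, map_one, map_div₀, map_one, Complex.conj_ofNat]
    module

theorem isAdjoint_schrodinger (hM : ∀ k : ℕ, superDim m n ≠ -(2 * k)) (V : Polynomial ℝ) :
    IsAdjoint (schrodinger m n V) (schrodinger m n V) := by
  have hkinetic := (isAdjoint_lap hM).smul (-(1 / 2))
  rw [map_neg, map_div₀, map_one, Complex.conj_ofNat] at hkinetic
  exact hkinetic.add ((isAdjoint_mulR2 hM).aeval_map V)

end Adjoint

end SuperSpace

end

theorem mainTheorem7_general (m n : ℕ) (hM : ∀ k : ℕ, SuperSpace.superDim m n ≠ -(2 * k)) :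
    (∃! T : SuperSpace.polyGauss m n →ₗ[ℂ] SuperSpace.polyGauss m n, SuperSpace.IsTwist m n T) ∧
    SuperSpace.IsAdjoint (SuperSpace.mulR2 m n) (SuperSpace.mulR2 m n) ∧
    SuperSpace.IsAdjoint (SuperSpace.lap m n) (SuperSpace.lap m n) ∧
    SuperSpace.IsAdjoint (SuperSpace.eulerShift m n) (-SuperSpace.eulerShift m n) ∧
    ∀ V : Polynomial ℝ,
      SuperSpace.IsAdjoint (SuperSpace.schrodinger m n V) (SuperSpace.schrodinger m n V) :=
  ⟨SuperSpace.existsUnique_isTwist hM, SuperSpace.isAdjoint_mulR2 hM, SuperSpace.isAdjoint_lap hM,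
    SuperSpace.isAdjoint_eulerShift hM, SuperSpace.isAdjoint_schrodinger hM⟩

theorem mainTheorem7 (m n : ℕ) (hM : 0 < SuperSpace.superDim m n) :
    (∃! T : SuperSpace.polyGauss m n →ₗ[ℂ] SuperSpace.polyGauss m n, SuperSpace.IsTwist m n T) ∧
    SuperSpace.IsAdjoint (SuperSpace.mulR2 m n) (SuperSpace.mulR2 m n) ∧
    SuperSpace.IsAdjoint (SuperSpace.lap m n) (SuperSpace.lap m n) ∧
    SuperSpace.IsAdjoint (SuperSpace.eulerShift m n) (-SuperSpace.eulerShift m n) ∧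
    ∀ V : Polynomial ℝ,
      SuperSpace.IsAdjoint (SuperSpace.schrodinger m n V) (SuperSpace.schrodinger m n V) :=
  mainTheorem7_general m n fun k => by omega
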